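/- Let $K$ be an algebraically closed field with $\mathrm{char}\,K\neq 2$, let $r\ge 0$ be an integer and let $0\neq\delta\in K$. **Hyperoctahedral groups.** For $n\ge 0$ let $W_n$ be the group of permutations $\sigma$ of $\{-n,\dots,-1,1,\dots,n\}$ with $\sigma(-x)=-\sigma(x)$, and $\mathcal W_n=KW_n$. For $\sigma\in W_n$ put $\operatorname{sgn}\sigma=(-1)^{k}\operatorname{sgn}|\sigma|$, where $k=\#\{i>0:\sigma(i)<0\}$ and $|\sigma|\in\mathfrak S_n$ is the permutation $i\mapsto|\sigma(i)|$. A bipartition of $n$ is a pair $\pmb\lambda=(\lambda^1,\lambda^2)$ of partitions with $|\lambda^1|+|\lambda^2|=n$ (partitions that differ only by zero parts are identified). Write $\pmb\lambda\trianglerighteq\pmb\mu$ if for all $j$ both $\sum_{i\le j}\lambda^1_i\ge\sum_{i\le j}\mu^1_i$ and $|\lambda^1|+\sum_{i\le j}\lambda^2_i\ge|\mu^1|+\sum_{i\le j}\mu^2_i$. A $\pmb\lambda$-bitableau $\mathfrak t=(\mathfrak t^1,\mathfrak t^2)$ is a filling of the boxes of the Young diagrams of $\lambda^1,\lambda^2$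 by elements of $\{\pm1,\dots,\pm n\}$ with distinct absolute values; $W_n$ acts on bitableaux from the right through the entries. Let $R_{\mathfrak t}\subseteq W_n$ be the subgroup of elements that permute the entries within each row and may change signs of entries of $\mathfrak t^2$ only, and $C_{\mathfrak t}\subseteq W_n$ the subgroup of elements that permute the entries within each column and may change signs of entries of $\mathfrak t^1$ only. A bitabloid $\{\mathfrak t\}$ is a class for the relation $\mathfrak t\sim\mathfrak t\sigma$ ($\sigma\in R_{\mathfrak t}$). Let $M(\pmb\lambda)$ be the right $\mathcal W_n$-module with basis the bitabloids, let $S(\pmb\lambda)\subseteq M(\pmb\lambda)$ be the submodule spanned by all $\sum_{\sigma\in C_{\mathfrak t}}(\operatorname{sgn}\sigma)\{\mathfrak t\sigma\}$, and let $S'(\pmb\lambda)=\operatorname{Hom}_K(S(\pmb\lambda),K)$ with $(\varphi\sigma)(x)=\varphi(x\sigma^{-1})$ (the dual Specht module). **Brauer algebra of type $C$.** A Brauer diagram of type $C_r$ is a perfect matching of the $4r$ vertices of two rows, each labelled $-r,\dots,-1,1,\dots,r$, that is invariant under the reflection $x\mapsto -x$ of both rows. Let $B=\mathcal B(C_r,\delta)$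 be the $K$-algebra with these diagrams as a basis, the product of two diagrams being their concatenation (first factor on top), where each closed loop is replaced by a factor $\delta$. For $l\ge 0$ let $J_l$ be the two-sided ideal of $B$ generated by all diagrams with at least $l$ horizontal edges in the top row. For $0\le l\le r$ let $e_l=\delta^{-l}d_l$, where $d_l$ is the diagram with horizontal edges $\{-i,i\}$ $(1\le i\le l)$ in both rows and vertical edges joining $i$ to $i$ for $|i|>l$. The group $W_{r-l}$ embeds in $B$ as diagrams without horizontal edges that move only the outer vertices $\pm(l+1),\dots,\pm r$; it commutes with $e_l$ and hence acts from the left on the right $B$-module $e_l(B/J_{l+1})$. For a right $\mathcal W_{r-l}$-module $M$ put $\operatorname{ind}_l M=M\otimes_{\mathcal W_{r-l}}e_l(B/J_{l+1})$, a right $B$-module. **Order.** Let $\Lambda=\{(l,\pmb\lambda):0\le l\le r,\ \pmb\lambda\text{ a bipartition of }r-l\}$, partially ordered by: $(m,\pmb\mu)\ge(l,\pmb\lambda)$ if $m<l$, or $m=l$ and $\pmb\lambda\trianglerighteq\pmb\mu$. **Lemma.** If $(l,\pmb\lambda),(m,\pmb\mu)\in\Lambda$ and $(m,\pmb\mu)>(l,\pmb\lambda)$,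 then $$\operatorname{Hom}_B\bigl(\operatorname{ind}_l S'(\pmb\lambda),\operatorname{ind}_m S'(\pmb\mu)\bigr)=0 .$$ -/

import Mathlib

/-- A Brauer diagram with top row `V` (the vertices `inl v`) and bottom row `V` (the vertices
`inr v`): a partition of the vertices into pairs (edges), given by the map that sends each vertex
to the other end of its edge. -/
@[ext]
structure BrauerDiagram (V : Type*) where
  partner : V ⊕ V → V ⊕ V
  partner_partner : ∀ x, partner (partner x) = x
  partner_ne : ∀ x, partner x ≠ x

namespace BrauerDiagram

variable {V : Type*}

/-! The vertices `V ⊕ V ⊕ V` are those of two stacked diagrams: `inl` is the top row,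
`inr (inl _)` the middle row and `inr (inr _)` the bottom row. -/

/-- The other end of the edge of `d`, where `d` joins the top row and the middle row. -/
def upper (d : BrauerDiagram V) : V ⊕ V ⊕ V → V ⊕ V ⊕ V
  | .inl a => Sum.map id Sum.inl (d.partner (.inl a))
  | .inr (.inl b) => Sum.map id Sum.inl (d.partner (.inr b))
  | .inr (.inr c) => .inr (.inr c)

/-- The other end of the edge of `e`, where `e` joins the middle row and the bottom row. -/
def lower (e : BrauerDiagram V) : V ⊕ V ⊕ V → V ⊕ V ⊕ V
  | .inl a => .inl a
  | .inr x => .inr (e.partner x)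

/-- The top and bottom rows inside the three rows. -/
def outer : V ⊕ V → V ⊕ V ⊕ V := Sum.map id Sum.inr

/-- Connectedness in the graph obtained by putting `d` on top of `e`. -/
def stack (d e : BrauerDiagram V) : Setoid (V ⊕ V ⊕ V) :=
  Relation.EqvGen.setoid fun x y => y = d.upper x ∨ y = e.lower x

theorem stack_upper (d e : BrauerDiagram V) (x : V ⊕ V ⊕ V) : stack d e x (d.upper x) :=
  .rel _ _ (.inl rfl)

theorem stack_lower (d e : BrauerDiagram V) (x : V ⊕ V ⊕ V) : stack d e x (e.lower x) :=
  .rel _ _ (.inr rfl)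

theorem upper_up (d : BrauerDiagram V) (x : V ⊕ V) :
    d.upper (Sum.map id Sum.inl x) = Sum.map id Sum.inl (d.partner x) := by
  rcases x with a | b <;> rfl

theorem upper_upper (d : BrauerDiagram V) (x : V ⊕ V ⊕ V) : d.upper (d.upper x) = x := by
  rcases x with a | b | c
  · rw [show d.upper (.inl a) = Sum.map id Sum.inl (d.partner (.inl a)) from rfl, upper_up,
      d.partner_partner]; rfl
  · rw [show d.upper (.inr (.inl b)) = Sum.map id Sum.inl (d.partner (.inr b)) from rfl, upper_up,
      d.partner_partner]; rfl
  · rfl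

theorem lower_lower (d : BrauerDiagram V) (x : V ⊕ V ⊕ V) : d.lower (d.lower x) = x := by
  rcases x with a | x
  · rfl
  · simp [lower, d.partner_partner]

theorem upper_eq_iff (d : BrauerDiagram V) (x : V ⊕ V ⊕ V) :
    d.upper x = x ↔ ∃ c, x = .inr (.inr c) := by
  have inj : Function.Injective (Sum.map id Sum.inl : V ⊕ V → V ⊕ V ⊕ V) :=
    Function.injective_id.sumMap Sum.inl_injective
  rcases x with a | b | c
  · have h := inj.ne (d.partner_ne (.inl a))
    exact ⟨fun h' => (h h').elim, by rintro ⟨c, ⟨⟩⟩⟩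
  · have h := inj.ne (d.partner_ne (.inr b))
    exact ⟨fun h' => (h h').elim, by rintro ⟨c, ⟨⟩⟩⟩
  · simp [upper]

theorem lower_eq_iff (d : BrauerDiagram V) (x : V ⊕ V ⊕ V) :
    d.lower x = x ↔ ∃ c, x = .inl c := by
  rcases x with a | x
  · simp [lower]
  · simpa [lower] using d.partner_ne x

theorem exists_outer_iff (d e : BrauerDiagram V) (x : V ⊕ V ⊕ V) :
    (∃ y, x = outer y) ↔ d.upper x = x ∨ e.lower x = x := by
  rw [upper_eq_iff, lower_eq_iff]
  rcases x with a | b | c <;> simp [outer]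

/-- Two involutions of a finite set without common fixed point: the class of a point fixed by `b`
contains exactly one other point that is fixed by `a` or `b`. -/
theorem existsUnique_end {T : Type*} [Finite T] (a b : T → T) (ha : ∀ x, a (a x) = x)
    (hb : ∀ x, b (b x) = x) (hab : ∀ x, ¬ (a x = x ∧ b x = x)) (x : T) (hx : b x = x) :
    ∃! y, y ≠ x ∧ (a y = y ∨ b y = y) ∧
      Relation.EqvGen (fun x y => y = a x ∨ y = b x) x y := by
  set A : Equiv.Perm T := ⟨a, a, ha, ha⟩ with hA
  set B : Equiv.Perm T := ⟨b, b, hb, hb⟩ with hB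
  have hAA : A * A = 1 := by ext y; exact ha y
  have hBB : B * B = 1 := by ext y; exact hb y
  set P : Equiv.Perm T := A * B with hP
  have hPi : B * P * B = P⁻¹ := by
    rw [eq_inv_iff_mul_eq_one, hP]
    calc B * (A * B) * B * (A * B) = B * A * (B * B) * A * B := by group
      _ = B * (A * A) * B := by rw [hBB]; group
      _ = 1 := by rw [hAA]; simpa using hBB
  have hBinv : B⁻¹ = B := by rw [inv_eq_iff_mul_eq_one, hBB]
  have hBP : ∀ k : ℤ, B * P ^ k = P ^ (-k) * B := by
    intro k
    have h1 : B * P ^ k * B⁻¹ = (B * P * B⁻¹) ^ k := (conj_zpow).symm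
    rw [hBinv, hPi] at h1
    rw [zpow_neg, ← inv_zpow, ← h1, mul_assoc, hBB, mul_one]
  have hb' : ∀ k : ℤ, b ((P ^ k) x) = (P ^ (-k)) x := by
    intro k
    have := congrArg (fun f : Equiv.Perm T => f x) (hBP k)
    simp only [Equiv.Perm.mul_apply] at this
    rw [show B x = x from hx] at this
    exact this
  have ha' : ∀ k : ℤ, a ((P ^ k) x) = (P ^ (1 - k)) x := by
    intro k
    have h2 : A = P * B := by rw [hP, mul_assoc, hBB, mul_one]
    calc a ((P ^ k) x) = (P * B) ((P ^ k) x) := by rw [← h2]; rfl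
      _ = P (b ((P ^ k) x)) := rfl
      _ = (P ^ (1 - k)) x := by
        rw [hb', ← Equiv.Perm.mul_apply, ← zpow_one_add]; rfl
  have hcl : ∀ y z, Relation.EqvGen (fun x y => y = a x ∨ y = b x) y z →
      ((∃ k : ℤ, y = (P ^ k) x) ↔ ∃ k : ℤ, z = (P ^ k) x) := by
    intro y z h
    induction h with
    | rel y z h =>
      rcases h with rfl | rfl
      · constructor
        · rintro ⟨k, rfl⟩; exact ⟨1 - k, ha' k⟩
        · rintro ⟨k, hk⟩; exact ⟨1 - k, by rw [← ha', ← hk, ha]⟩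
      · constructor
        · rintro ⟨k, rfl⟩; exact ⟨- k, hb' k⟩
        · rintro ⟨k, hk⟩; exact ⟨- k, by rw [← hb', ← hk, hb]⟩
    | refl => rfl
    | symm _ _ _ ih => exact ih.symm
    | trans _ _ _ _ _ ih1 ih2 => exact ih1.trans ih2
  have hra : ∀ y, Relation.EqvGen (fun x y => y = a x ∨ y = b x) y (a y) :=
    fun y => .rel _ _ (.inl rfl)
  have hrb : ∀ y, Relation.EqvGen (fun x y => y = a x ∨ y = b x) y (b y) :=
    fun y => .rel _ _ (.inr rfl)
  have hP1 : ∀ y, Relation.EqvGen (fun x y => y = a x ∨ y = b x) y (P y) :=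
    fun y => .trans _ _ _ (hrb y) (hra (b y))
  have hPn : ∀ (k : ℕ) y, Relation.EqvGen (fun x y => y = a x ∨ y = b x) y ((P ^ k) y) := by
    intro k
    induction k with
    | zero => intro y; exact .refl _
    | succ k ih => intro y; rw [pow_succ]; exact .trans _ _ _ (hP1 y) (ih (P y))
  have hper : ∀ i j : ℤ, (P ^ i) x = (P ^ j) x ↔
      (Function.minimalPeriod (P • · : T → T) x : ℤ) ∣ i - j := by
    intro i j
    rw [← MulAction.zpow_smul_eq_iff_minimalPeriod_dvd, Equiv.Perm.smul_def,
      show i - j = -j + i by ring, zpow_add, zpow_neg, Equiv.Perm.mul_apply,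
      Equiv.Perm.inv_eq_iff_eq]
  have hpos : 0 < Function.minimalPeriod (P • · : T → T) x := by
    apply Function.minimalPeriod_pos_of_mem_periodicPts
    exact ⟨orderOf P, orderOf_pos P, by
      rw [Function.IsPeriodicPt, Function.IsFixedPt, smul_iterate, pow_orderOf_eq_one]; simp⟩
  set n := Function.minimalPeriod (P • · : T → T) x
  have hx0 : ∀ k : ℤ, (P ^ k) x = x ↔ (n : ℤ) ∣ k := by
    intro k
    simpa using hper k 0
  rcases Nat.even_or_odd' n with ⟨q, hq | hq⟩
  · have hbq : b ((P ^ (q : ℤ)) x) = (P ^ (q : ℤ)) x := by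
      rw [hb', hper]; exact ⟨-1, by rw [hq]; push_cast; ring⟩
    refine ⟨(P ^ (q : ℤ)) x, ⟨?_, .inr hbq, ?_⟩, ?_⟩
    · rw [Ne, hx0]
      intro h
      have := Int.le_of_dvd (by omega) h
      omega
    · rw [zpow_natCast]; exact hPn q x
    · rintro z ⟨hzx, hz, hxz⟩
      obtain ⟨k, rfl⟩ := (hcl _ _ hxz).1 ⟨0, by simp⟩
      rw [Ne, hx0] at hzx
      rw [ha', hb', hper, hper] at hz
      rw [hper]
      rcases hz with ⟨c, hc⟩ | ⟨c, hc⟩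
      · exfalso
        rw [hq] at hc
        push_cast at hc
        have : (1 : ℤ) = 2 * (q * c + k) := by linarith
        omega
      · rw [hq] at hc hzx ⊢
        push_cast at hc hzx ⊢
        have hk : k = q * (- c) := by linarith
        rcases Int.even_or_odd' c with ⟨e, rfl | rfl⟩
        · exact (hzx ⟨-e, by rw [hk]; ring⟩).elim
        · exact ⟨-e - 1, by rw [hk]; ring⟩
  · have hqa : a ((P ^ ((q + 1 : ℕ) : ℤ)) x) = (P ^ ((q + 1 : ℕ) : ℤ)) x := by
      rw [ha', hper]; exact ⟨-1, by rw [hq]; push_cast; ring⟩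
    refine ⟨(P ^ ((q + 1 : ℕ) : ℤ)) x, ⟨?_, .inl hqa, ?_⟩, ?_⟩
    · intro h
      rw [h] at hqa
      exact hab x ⟨hqa, hx⟩
    · rw [zpow_natCast]; exact hPn (q + 1) x
    · rintro z ⟨hzx, hz, hxz⟩
      obtain ⟨k, rfl⟩ := (hcl _ _ hxz).1 ⟨0, by simp⟩
      rw [Ne, hx0] at hzx
      rw [ha', hb', hper, hper] at hz
      rw [hper]
      have hcop : IsCoprime (n : ℤ) 2 := ⟨1, -q, by rw [hq]; push_cast; ring⟩
      rcases hz with ⟨c, hc⟩ | ⟨c, hc⟩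
      · refine hcop.dvd_of_dvd_mul_left (z := k - ((q + 1 : ℕ) : ℤ)) ⟨-c - 1, ?_⟩
        rw [hq] at hc ⊢
        push_cast at hc ⊢
        linear_combination -hc
      · exact (hzx (hcop.dvd_of_dvd_mul_left (z := k) ⟨-c, by linear_combination -hc⟩)).elim

theorem existsUnique_outer [Finite V] (d e : BrauerDiagram V) (x : V ⊕ V) :
    ∃! y, y ≠ x ∧ stack d e (outer x) (outer y) := by
  have inj : Function.Injective (outer : V ⊕ V → V ⊕ V ⊕ V) :=
    Function.injective_id.sumMap Sum.inr_injective
  have hno : ∀ z, ¬ (d.upper z = z ∧ e.lower z = z) := by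
    intro z
    rw [upper_eq_iff, lower_eq_iff]
    rintro ⟨⟨c, rfl⟩, ⟨c', ⟨⟩⟩⟩
  suffices h : ∃! y, y ≠ outer x ∧ (d.upper y = y ∨ e.lower y = y) ∧ stack d e (outer x) y by
    obtain ⟨y, ⟨h1, h2, h3⟩, h4⟩ := h
    obtain ⟨y, rfl⟩ := (exists_outer_iff d e y).2 h2
    refine ⟨y, ⟨fun h => h1 (by rw [h]), h3⟩, fun z hz => inj (h4 _ ⟨inj.ne hz.1, ?_, hz.2⟩)⟩
    exact (exists_outer_iff d e _).1 ⟨z, rfl⟩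
  rcases (exists_outer_iff d e (outer x)).1 ⟨x, rfl⟩ with h | h
  · have := existsUnique_end e.lower d.upper e.lower_lower d.upper_upper
      (fun z hz => hno z hz.symm) (outer x) h
    convert this using 4 with y
    · exact or_comm
    · rw [stack, Relation.EqvGen.setoid]
      simp only [or_comm]
  · exact existsUnique_end d.upper e.lower d.upper_upper e.lower_lower hno (outer x) h

/-- Concatenation of diagrams, `d` on top of `e`: every vertex of the outer rows is joined to the
unique other vertex of the outer rows in its connected component. -/
noncomputable def comp [Finite V] (d e : BrauerDiagram V) : BrauerDiagram V where
  partner x := (existsUnique_outer d e x).choose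
  partner_partner x := by
    have h := (existsUnique_outer d e x).choose_spec.1
    have h' := (existsUnique_outer d e (existsUnique_outer d e x).choose).choose_spec.2
    exact (h' x ⟨h.1.symm, (stack d e).symm h.2⟩).symm
  partner_ne x := (existsUnique_outer d e x).choose_spec.1.1

theorem stack_outer_iff [Finite V] (d e : BrauerDiagram V) (x y : V ⊕ V) :
    stack d e (outer x) (outer y) ↔ y = x ∨ y = (d.comp e).partner x := by
  have h := (existsUnique_outer d e x).choose_spec
  constructor
  · intro hxy
    by_cases hy : y = x
    · exact .inl hy
    · exact .inr (h.2 y ⟨hy, hxy⟩)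
  · rintro (rfl | rfl)
    · exact (stack d e).refl _
    · exact h.1.2

theorem comp_partner_eq_iff [Finite V] (d e : BrauerDiagram V) (x y : V ⊕ V) :
    (d.comp e).partner x = y ↔ y ≠ x ∧ stack d e (outer x) (outer y) := by
  rw [stack_outer_iff]
  constructor
  · rintro rfl
    exact ⟨(d.comp e).partner_ne x, .inr rfl⟩
  · rintro ⟨h, h' | h'⟩
    · exact (h h').elim
    · exact h'.symm

/-- The number of closed loops that are removed when `d` is put on top of `e`: the number of
connected components that lie in the middle row. -/
noncomputable def loops (d e : BrauerDiagram V) : ℕ :=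
  Nat.card {c : Quotient (stack d e) // ∀ x, Quotient.mk (stack d e) (outer x) ≠ c}

/-- Abstract form of the comparison of two ways to stack three diagrams. -/
theorem glue_equiv {T U Z O : Type*} (rT : T → T → Prop) (sU : Setoid U) (sZ : Setoid Z)
    (k : U → T) (h : Z → T) (i : O → U) (j : O → Z)
    (hk : Function.Injective k) (hh : Function.Injective h)
    (hcov : ∀ t, (∃ z, t = h z) ∨ ∃ u, t = k u)
    (hkh : ∀ u z, k u = h z → ∃ o, u = i o ∧ z = j o) (hij : ∀ o, k (i o) = h (j o))
    (hT : ∀ x y, rT x y →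
      (∃ u v, x = k u ∧ y = k v ∧ sU u v) ∨ ∃ z w, x = h z ∧ y = h w ∧ sZ z w)
    (hU : ∀ u v, sU u v → Relation.EqvGen rT (k u) (k v))
    (hZ : ∀ z w, sZ z w → Relation.EqvGen rT (h z) (h w))
    (hO : ∀ o o', sU (i o) (i o') → sZ (j o) (j o')) :
    ∃ E : Quotient sZ ⊕ {c : Quotient sU // ∀ o, Quotient.mk sU (i o) ≠ c} ≃
        Quotient (Relation.EqvGen.setoid rT),
      ∀ z, E (.inl (Quotient.mk sZ z)) = Quotient.mk _ (h z) := by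
  set sT := Relation.EqvGen.setoid rT with hsT
  -- invariant sets
  have inv : ∀ S : Set T,
      (∀ u v, sU u v → k u ∈ S → k v ∈ S) → (∀ z w, sZ z w → h z ∈ S → h w ∈ S) →
      ∀ x y, Relation.EqvGen rT x y → (x ∈ S ↔ y ∈ S) := by
    intro S h1 h2 x y hxy
    induction hxy with
    | rel x y hxy =>
      rcases hT x y hxy with ⟨u, v, rfl, rfl, huv⟩ | ⟨u, v, rfl, rfl, huv⟩
      · exact ⟨h1 _ _ huv, h1 _ _ (sU.symm huv)⟩
      · exact ⟨h2 _ _ huv, h2 _ _ (sZ.symm huv)⟩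
    | refl => rfl
    | symm _ _ _ ih => exact ih.symm
    | trans _ _ _ _ _ ih1 ih2 => exact ih1.trans ih2
  have invZ : ∀ z x y, Relation.EqvGen rT x y →
      (x ∈ {t | (∃ w, t = h w ∧ sZ z w) ∨ ∃ u o, t = k u ∧ sU u (i o) ∧ sZ z (j o)} ↔
        y ∈ {t | (∃ w, t = h w ∧ sZ z w) ∨ ∃ u o, t = k u ∧ sU u (i o) ∧ sZ z (j o)}) := by
    intro z
    apply inv
    · rintro u v huv (⟨w, hw, hzw⟩ | ⟨u', o, hu', huo, hzo⟩)
      · obtain ⟨o, rfl, rfl⟩ := hkh _ _ hw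
        exact .inr ⟨v, o, rfl, sU.symm huv, hzw⟩
      · obtain rfl := hk hu'
        exact .inr ⟨v, o, rfl, sU.trans (sU.symm huv) huo, hzo⟩
    · rintro w w' hww (⟨w1, hw, hzw⟩ | ⟨u', o, hu', huo, hzo⟩)
      · obtain rfl := hh hw
        exact .inl ⟨w', rfl, sZ.trans hzw hww⟩
      · obtain ⟨o', rfl, rfl⟩ := hkh _ _ hu'.symm
        exact .inl ⟨w', rfl, sZ.trans (sZ.trans hzo (sZ.symm (hO _ _ huo))) hww⟩
  have invU : ∀ u0, (∀ o, ¬ sU (i o) u0) → ∀ x y, Relation.EqvGen rT x y →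
      (x ∈ {t | ∃ u, t = k u ∧ sU u0 u} ↔ y ∈ {t | ∃ u, t = k u ∧ sU u0 u}) := by
    intro u0 hu0
    apply inv
    · rintro u v huv ⟨u', hu', huu⟩
      obtain rfl := hk hu'
      exact ⟨v, rfl, sU.trans huu huv⟩
    · rintro z w hzw ⟨u, hu, huu⟩
      obtain ⟨o, rfl, rfl⟩ := hkh _ _ hu.symm
      exact (hu0 o (sU.symm huu)).elim
  let G : Quotient sZ ⊕ {c : Quotient sU // ∀ o, Quotient.mk sU (i o) ≠ c} → Quotient sT :=
    Sum.elim (Quotient.map' h hZ) (fun c => Quotient.map' k hU c.1)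
  have hG : Function.Bijective G := by
    constructor
    · rintro (z | ⟨c, hc⟩) (w | ⟨c', hc'⟩) hzw
      · induction z using Quotient.ind with | _ z
        induction w using Quotient.ind with | _ w
        have hzw : Relation.EqvGen rT (h z) (h w) := Quotient.exact hzw
        rcases (invZ z _ _ hzw).1 (.inl ⟨z, rfl, sZ.refl z⟩) with ⟨w', hw, hzw'⟩ | ⟨u, o, hu, huo, hzo⟩
        · obtain rfl := hh hw
          exact congrArg _ (Quotient.sound hzw')
        · obtain ⟨o', rfl, rfl⟩ := hkh _ _ hu.symm
          exact congrArg _ (Quotient.sound (sZ.trans hzo (sZ.symm (hO _ _ huo))))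
      · exfalso
        induction z using Quotient.ind with | _ z
        induction c' using Quotient.ind with | _ u
        have hzw : Relation.EqvGen rT (h z) (k u) := Quotient.exact hzw
        have hu0 : ∀ o, ¬ sU (i o) u := fun o ho => hc' o (Quotient.sound ho)
        obtain ⟨v, hv, huv⟩ := (invU u hu0 _ _ hzw).2 ⟨u, rfl, sU.refl u⟩
        obtain ⟨o, rfl, rfl⟩ := hkh _ _ hv.symm
        exact hu0 o (sU.symm huv)
      · exfalso
        induction w using Quotient.ind with | _ z
        induction c using Quotient.ind with | _ u
        have hzw : Relation.EqvGen rT (k u) (h z) := Quotient.exact hzw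
        have hu0 : ∀ o, ¬ sU (i o) u := fun o ho => hc o (Quotient.sound ho)
        obtain ⟨v, hv, huv⟩ := (invU u hu0 _ _ hzw).1 ⟨u, rfl, sU.refl u⟩
        obtain ⟨o, rfl, rfl⟩ := hkh _ _ hv.symm
        exact hu0 o (sU.symm huv)
      · induction c using Quotient.ind with | _ u
        induction c' using Quotient.ind with | _ v
        have hzw : Relation.EqvGen rT (k u) (k v) := Quotient.exact hzw
        have hu0 : ∀ o, ¬ sU (i o) u := fun o ho => hc o (Quotient.sound ho)
        obtain ⟨v', hv, huv⟩ := (invU u hu0 _ _ hzw).1 ⟨u, rfl, sU.refl u⟩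
        obtain rfl := hk hv
        congr 2
        exact Quotient.sound huv
    · intro t
      induction t using Quotient.ind with | _ t
      rcases hcov t with ⟨z, rfl⟩ | ⟨u, rfl⟩
      · exact ⟨.inl (Quotient.mk _ z), rfl⟩
      · by_cases hu : ∃ o, sU (i o) u
        · obtain ⟨o, ho⟩ := hu
          refine ⟨.inl (Quotient.mk _ (j o)), ?_⟩
          refine (Quotient.sound ?_ : Quotient.mk sT (h (j o)) = Quotient.mk sT (k u))
          rw [← hij]
          exact hU _ _ ho
        · exact ⟨.inr ⟨Quotient.mk _ u, fun o ho => hu ⟨o, Quotient.exact ho⟩⟩, rfl⟩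
  exact ⟨Equiv.ofBijective G hG, fun z => rfl⟩

theorem stack_le (d e : BrauerDiagram V) (S : Setoid (V ⊕ V ⊕ V))
    (h1 : ∀ u : V ⊕ V, S (Sum.map id Sum.inl u) (Sum.map id Sum.inl (d.partner u)))
    (h2 : ∀ u : V ⊕ V, S (Sum.inr u) (Sum.inr (e.partner u))) (x y : V ⊕ V ⊕ V)
    (hxy : stack d e x y) : S x y := by
  have hxy : Relation.EqvGen (fun x y => y = d.upper x ∨ y = e.lower x) x y := hxy
  induction hxy with
  | rel x y h =>
    rcases h with rfl | rfl
    · rcases x with a | b | c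
      · exact h1 (.inl a)
      · exact h1 (.inr b)
      · exact S.refl _
    · rcases x with a | u
      · exact S.refl _
      · exact h2 u
  | refl => exact S.refl _
  | symm _ _ _ ih => exact S.symm (ih ‹_›)
  | trans _ _ _ _ _ ih1 ih2 => exact S.trans (ih1 ‹_›) (ih2 ‹_›)

theorem stack_up (d e : BrauerDiagram V) (u : V ⊕ V) :
    stack d e (Sum.map id Sum.inl u) (Sum.map id Sum.inl (d.partner u)) := by
  rw [← upper_up]
  exact stack_upper d e _

theorem stack_inr (d e : BrauerDiagram V) (u : V ⊕ V) :
    stack d e (Sum.inr u) (Sum.inr (e.partner u)) :=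
  stack_lower d e (.inr u)

/-- The edges of three stacked diagrams. -/
def Step4 (d e f : BrauerDiagram V) (x y : V ⊕ V ⊕ V ⊕ V) : Prop :=
  (∃ u, x = Sum.map id Sum.inl u ∧ y = Sum.map id Sum.inl (d.partner u)) ∨
  (∃ u, x = Sum.inr (Sum.map id Sum.inl u) ∧ y = Sum.inr (Sum.map id Sum.inl (e.partner u))) ∨
  ∃ u, x = Sum.inr (Sum.inr u) ∧ y = Sum.inr (Sum.inr (f.partner u))

theorem exists_equiv_left [Finite V] (d e f : BrauerDiagram V) :
    ∃ E : Quotient (stack (d.comp e) f) ⊕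
        {c : Quotient (stack d e) // ∀ o, Quotient.mk (stack d e) (outer o) ≠ c} ≃
        Quotient (Relation.EqvGen.setoid (Step4 d e f)),
      ∀ z, E (.inl (Quotient.mk _ z)) = Quotient.mk _ (Sum.map id Sum.inr z) := by
  have hU : ∀ u v, stack d e u v → Relation.EqvGen (Step4 d e f)
      (Sum.map id (Sum.map id Sum.inl) u) (Sum.map id (Sum.map id Sum.inl) v) := by
    apply stack_le d e (Setoid.comap _ (Relation.EqvGen.setoid (Step4 d e f)))
    · refine fun u => .rel _ _ (.inl ⟨u, ?_, ?_⟩)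
      · rcases u with u | u <;> rfl
      · rcases d.partner u with u | u <;> rfl
    · exact fun u => .rel _ _ (.inr (.inl ⟨u, rfl, rfl⟩))
  apply glue_equiv (Step4 d e f) (stack d e) (stack (d.comp e) f)
    (Sum.map id (Sum.map id Sum.inl)) (Sum.map id Sum.inr) outer (Sum.map id Sum.inl)
  · exact Function.injective_id.sumMap (Function.injective_id.sumMap Sum.inl_injective)
  · exact Function.injective_id.sumMap Sum.inr_injective
  · rintro (a | b | c | c)
    · exact .inl ⟨.inl a, rfl⟩
    · exact .inr ⟨.inr (.inl b), rfl⟩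
    · exact .inl ⟨.inr (.inl c), rfl⟩
    · exact .inl ⟨.inr (.inr c), rfl⟩
  · rintro (a | b | c) (a' | b' | c') h <;> simp at h
    · exact ⟨.inl a, rfl, by simp [h]⟩
    · exact ⟨.inr c, rfl, by simp [h]⟩
  · rintro (a | b) <;> rfl
  · rintro x y (⟨u, rfl, rfl⟩ | ⟨u, rfl, rfl⟩ | ⟨u, rfl, rfl⟩)
    · refine .inl ⟨_, _, ?_, ?_, stack_up d e u⟩
      · rcases u with u | u <;> rfl
      · rcases d.partner u with u | u <;> rfl
    · exact .inl ⟨_, _, rfl, rfl, stack_inr d e u⟩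
    · exact .inr ⟨_, _, rfl, rfl, stack_inr (d.comp e) f u⟩
  · exact hU
  · apply stack_le (d.comp e) f (Setoid.comap _ (Relation.EqvGen.setoid (Step4 d e f)))
    · intro u
      have h := hU _ _ ((stack_outer_iff d e u _).2 (.inr rfl))
      refine (Eq.mp ?_ h : Relation.EqvGen (Step4 d e f) _ _)
      congr 1
      · rcases u with u | u <;> rfl
      · rcases (d.comp e).partner u with u | u <;> rfl
    · exact fun u => .rel _ _ (.inr (.inr ⟨u, rfl, rfl⟩))
  · intro o o' h
    rcases (stack_outer_iff d e o o').1 h with rfl | rfl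
    · exact (stack (d.comp e) f).refl _
    · exact stack_up (d.comp e) f o

theorem exists_equiv_right [Finite V] (d e f : BrauerDiagram V) :
    ∃ E : Quotient (stack d (e.comp f)) ⊕
        {c : Quotient (stack e f) // ∀ o, Quotient.mk (stack e f) (outer o) ≠ c} ≃
        Quotient (Relation.EqvGen.setoid (Step4 d e f)),
      ∀ z, E (.inl (Quotient.mk _ z)) = Quotient.mk _ (Sum.map id outer z) := by
  have hU : ∀ u v, stack e f u v → Relation.EqvGen (Step4 d e f) (Sum.inr u) (Sum.inr v) := by
    apply stack_le e f (Setoid.comap Sum.inr (Relation.EqvGen.setoid (Step4 d e f)))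
    · exact fun u => .rel _ _ (.inr (.inl ⟨u, rfl, rfl⟩))
    · exact fun u => .rel _ _ (.inr (.inr ⟨u, rfl, rfl⟩))
  apply glue_equiv (Step4 d e f) (stack e f) (stack d (e.comp f))
    Sum.inr (Sum.map id outer) outer Sum.inr
  · exact Sum.inr_injective
  · exact Function.injective_id.sumMap (Function.injective_id.sumMap Sum.inr_injective)
  · rintro (a | u)
    · exact .inl ⟨.inl a, rfl⟩
    · exact .inr ⟨u, rfl⟩
  · rintro u (a | z) h <;> simp at h
    exact ⟨z, h, rfl⟩
  · intro o; rfl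
  · rintro x y (⟨u, rfl, rfl⟩ | ⟨u, rfl, rfl⟩ | ⟨u, rfl, rfl⟩)
    · refine .inr ⟨_, _, ?_, ?_, stack_up d (e.comp f) u⟩
      · rcases u with u | u <;> rfl
      · rcases d.partner u with u | u <;> rfl
    · exact .inl ⟨_, _, rfl, rfl, stack_up e f u⟩
    · exact .inl ⟨_, _, rfl, rfl, stack_inr e f u⟩
  · exact hU
  · apply stack_le d (e.comp f) (Setoid.comap _ (Relation.EqvGen.setoid (Step4 d e f)))
    · refine fun u => .rel _ _ (.inl ⟨u, ?_, ?_⟩)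
      · rcases u with u | u <;> rfl
      · rcases d.partner u with u | u <;> rfl
    · exact fun u => hU _ _ ((stack_outer_iff e f u _).2 (.inr rfl))
  · intro o o' h
    rcases (stack_outer_iff e f o o').1 h with rfl | rfl
    · exact (stack d (e.comp f)).refl _
    · exact stack_inr d (e.comp f) o

theorem card_of_equiv {X Q L T : Type*} [Finite Q] [Finite L] (E : Q ⊕ L ≃ T) (p : X → Q)
    (q : X → T) (h : ∀ x, E (.inl (p x)) = q x) :
    Nat.card {t : T // ∀ x, q x ≠ t} = Nat.card {c : Q // ∀ x, p x ≠ c} + Nat.card L := by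
  rw [← Nat.card_sum]
  have e1 : {t : T // ∀ x, q x ≠ t} ≃ {s : Q ⊕ L // ∀ x, .inl (p x) ≠ s} :=
    (E.subtypeEquiv fun s => by simp [← h]).symm
  have e2 : {b : L // ∀ x : X, (Sum.inl (p x) : Q ⊕ L) ≠ .inr b} ≃ L :=
    Equiv.subtypeUnivEquiv (by simp)
  have e3 : {c : Q // ∀ x : X, (Sum.inl (p x) : Q ⊕ L) ≠ .inl c} ≃ {c : Q // ∀ x, p x ≠ c} :=
    Equiv.subtypeEquivRight (by simp)
  exact Nat.card_congr (e1.trans (Equiv.subtypeSum.trans (e3.sumCongr e2)))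

theorem comp_assoc [Finite V] (d e f : BrauerDiagram V) :
    (d.comp e).comp f = d.comp (e.comp f) := by
  obtain ⟨E, hE⟩ := exists_equiv_left d e f
  obtain ⟨E', hE'⟩ := exists_equiv_right d e f
  have h : ∀ x y, stack (d.comp e) f (outer x) (outer y) ↔
      stack d (e.comp f) (outer x) (outer y) := by
    intro x y
    have hx : ∀ x : V ⊕ V, Sum.map id Sum.inr (outer x) = Sum.map id outer (outer x) := by
      rintro (a | a) <;> rfl
    rw [← Quotient.eq (r := stack (d.comp e) f), ← Quotient.eq (r := stack d (e.comp f)),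
      ← Sum.inl_injective.eq_iff, ← E.injective.eq_iff, hE, hE, hx, hx, ← hE', ← hE',
      E'.injective.eq_iff, Sum.inl_injective.eq_iff]
  ext1
  funext x
  rw [comp_partner_eq_iff, h, ← comp_partner_eq_iff]

theorem loops_add [Finite V] (d e f : BrauerDiagram V) :
    loops d e + loops (d.comp e) f = loops e f + loops d (e.comp f) := by
  obtain ⟨E, hE⟩ := exists_equiv_left d e f
  obtain ⟨E', hE'⟩ := exists_equiv_right d e f
  have h1 := card_of_equiv E (fun x : V ⊕ V => Quotient.mk _ (outer x)) _ (fun x => hE (outer x))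
  have h2 := card_of_equiv E' (fun x : V ⊕ V => Quotient.mk _ (outer x)) _ (fun x => hE' (outer x))
  have hx : ∀ x : V ⊕ V, Sum.map id Sum.inr (outer x) = Sum.map id outer (outer x) := by
    rintro (a | a) <;> rfl
  simp only [hx] at h1
  unfold loops
  omega

theorem comp_partner_map [Finite V] (d e : BrauerDiagram V) (s : V → V)
    (hs : Function.Injective s) (hd : ∀ x, d.partner (Sum.map s s x) = Sum.map s s (d.partner x))
    (he : ∀ x, e.partner (Sum.map s s x) = Sum.map s s (e.partner x)) (x : V ⊕ V) :
    (d.comp e).partner (Sum.map s s x) = Sum.map s s ((d.comp e).partner x) := by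
  rw [comp_partner_eq_iff]
  refine ⟨(hs.sumMap hs).ne ((d.comp e).partner_ne x), ?_⟩
  have key := stack_le d e (Setoid.comap (Sum.map s (Sum.map s s)) (stack d e)) (fun u => by
    have h := stack_up d e (Sum.map s s u)
    rw [hd] at h
    have hup : ∀ x : V ⊕ V, Sum.map s (Sum.map s s) (Sum.map id Sum.inl x) =
        Sum.map id Sum.inl (Sum.map s s x) := by
      rintro (a | a) <;> rfl
    rw [← hup, ← hup] at h
    exact h) (fun u => by
    have h := stack_inr d e (Sum.map s s u)
    rw [he] at h
    exact h) _ _ ((stack_outer_iff d e x _).2 (.inr rfl))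
  have hout : ∀ x : V ⊕ V, Sum.map s (Sum.map s s) (outer x) = outer (Sum.map s s x) := by
    rintro (a | a) <;> rfl
  rw [← hout, ← hout]
  exact key

/-- The diagram of a permutation, with vertical edges from `σ x` in the top row to `x` in the
bottom row. With this choice concatenation of diagrams is multiplication of permutations. -/
def ofPerm (σ : Equiv.Perm V) : BrauerDiagram V where
  partner := Sum.elim (fun y => .inr (σ.symm y)) (fun x => .inl (σ x))
  partner_partner := by rintro (x | x) <;> simp
  partner_ne := by rintro (x | x) <;> simp

theorem ofPerm_comp_partner [Finite V] (σ : Equiv.Perm V) (d : BrauerDiagram V) (x : V ⊕ V) :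
    ((ofPerm σ).comp d).partner (Sum.map σ id x) = Sum.map σ id (d.partner x) := by
  have key : ∀ x : V ⊕ V, stack (ofPerm σ) d (outer (Sum.map σ id x)) (.inr x) := by
    rintro (v | v)
    · exact (stack _ _).symm (stack_up (ofPerm σ) d (.inr v))
    · exact (stack _ _).refl _
  rw [comp_partner_eq_iff]
  refine ⟨(σ.injective.sumMap Function.injective_id).ne (d.partner_ne x), ?_⟩
  exact (stack _ _).trans (key x)
    ((stack _ _).trans (stack_inr (ofPerm σ) d x) ((stack _ _).symm (key _)))

theorem comp_ofPerm_partner [Finite V] (d : BrauerDiagram V) (σ : Equiv.Perm V) (x : V ⊕ V) :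
    (d.comp (ofPerm σ)).partner (Sum.map id σ.symm x) = Sum.map id σ.symm (d.partner x) := by
  have key : ∀ x : V ⊕ V,
      stack d (ofPerm σ) (outer (Sum.map id σ.symm x)) (Sum.map id Sum.inl x) := by
    rintro (v | v)
    · exact (stack _ _).refl _
    · exact (stack _ _).symm (stack_inr d (ofPerm σ) (.inl v))
  rw [comp_partner_eq_iff]
  refine ⟨(Function.injective_id.sumMap σ.symm.injective).ne (d.partner_ne x), ?_⟩
  exact (stack _ _).trans (key x)
    ((stack _ _).trans (stack_up d (ofPerm σ) x) ((stack _ _).symm (key _)))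

theorem loops_ofPerm_left (σ : Equiv.Perm V) (d : BrauerDiagram V) :
    loops (ofPerm σ) d = 0 := by
  rw [loops, Nat.card_eq_zero]
  refine .inl ⟨fun c => ?_⟩
  obtain ⟨c, hc⟩ := c
  induction c using Quotient.ind with | _ x
  rcases x with a | b | b
  · exact hc (.inl a) rfl
  · exact hc (.inl (σ b)) (Quotient.sound ((stack _ _).symm (stack_up (ofPerm σ) d (.inr b))))
  · exact hc (.inr b) rfl

theorem loops_ofPerm_right (d : BrauerDiagram V) (σ : Equiv.Perm V) :
    loops d (ofPerm σ) = 0 := by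
  rw [loops, Nat.card_eq_zero]
  refine .inl ⟨fun c => ?_⟩
  obtain ⟨c, hc⟩ := c
  induction c using Quotient.ind with | _ x
  rcases x with a | b | b
  · exact hc (.inl a) rfl
  · exact hc (.inr (σ.symm b))
      (Quotient.sound ((stack _ _).symm (stack_inr d (ofPerm σ) (.inl b))))
  · exact hc (.inr b) rfl

end BrauerDiagram

/-- The set `{-n, …, -1, 1, …, n}`, where `(i, ε)` stands for `ε * (i + 1)`. -/
abbrev Vertex (n : ℕ) : Type := Fin n × ℤˣ

/-- `x ↦ -x`, the reflection of a row of vertices in the vertical axis. -/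
def Vertex.neg {n : ℕ} (x : Vertex n) : Vertex n := (x.1, -x.2)

theorem Vertex.neg_neg {n : ℕ} (x : Vertex n) : x.neg.neg = x := by simp [Vertex.neg]

theorem Vertex.neg_injective {n : ℕ} : Function.Injective (Vertex.neg (n := n)) :=
  Function.Involutive.injective Vertex.neg_neg

/-- The hyperoctahedral group `W_n`: the permutations `σ` of `{-n, …, -1, 1, …, n}` with
`σ (-x) = -σ x`. -/
def Hyperoctahedral (n : ℕ) : Subgroup (Equiv.Perm (Vertex n)) where
  carrier := {σ | ∀ x : Vertex n, σ x.neg = (σ x).neg}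
  one_mem' _ := rfl
  mul_mem' {σ τ} hσ hτ x := by
    rw [Equiv.Perm.mul_apply, hτ x, hσ]; rfl
  inv_mem' {σ} hσ x := by
    rw [Equiv.Perm.inv_eq_iff_eq, hσ]; simp

/-- Brauer diagrams of type `C_r`: the Brauer diagrams on two rows of vertices
`-r, …, -1, 1, …, r` that are symmetric with respect to the vertical axis. -/
def DiagramC (r : ℕ) : Type :=
  {d : BrauerDiagram (Vertex r) //
    ∀ x, d.partner (Sum.map Vertex.neg Vertex.neg x) = Sum.map Vertex.neg Vertex.neg (d.partner x)}

namespace DiagramC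

variable {r : ℕ}

/-- Concatenation with closed loops removed. -/
noncomputable instance : Mul (DiagramC r) where
  mul d e := ⟨d.1.comp e.1, d.1.comp_partner_map e.1 _ Vertex.neg_injective d.2 e.2⟩

/-- The diagram without horizontal edges given by an element of the hyperoctahedral group. -/
def ofPerm (σ : Hyperoctahedral r) : DiagramC r where
  val := BrauerDiagram.ofPerm σ.1
  property := by
    rintro (x | x)
    · have h : (σ.1).symm x.neg = ((σ.1).symm x).neg := (σ⁻¹).2 x
      simp [BrauerDiagram.ofPerm, h]
    · simp [BrauerDiagram.ofPerm, σ.2 x]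

instance : One (DiagramC r) := ⟨ofPerm 1⟩

/-- The number of closed loops arising in the concatenation of `d` and `e`. -/
noncomputable def loops (d e : DiagramC r) : ℕ := d.1.loops e.1

noncomputable instance : Monoid (DiagramC r) where
  mul_assoc d e f := Subtype.ext (BrauerDiagram.comp_assoc d.1 e.1 f.1)
  one_mul d := by
    refine Subtype.ext (BrauerDiagram.ext (funext fun x => ?_))
    have h := BrauerDiagram.ofPerm_comp_partner 1 d.1 x
    rw [Equiv.Perm.coe_one, Sum.map_id_id, id, id] at h
    exact h
  mul_one d := by
    refine Subtype.ext (BrauerDiagram.ext (funext fun x => ?_))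
    have h := BrauerDiagram.comp_ofPerm_partner d.1 1 x
    rw [show (⇑(Equiv.symm (1 : Equiv.Perm (Vertex r)))) = id from rfl, Sum.map_id_id, id, id] at h
    exact h

theorem ofPerm_mul (σ τ : Hyperoctahedral r) : ofPerm σ * ofPerm τ = ofPerm (σ * τ) := by
  refine Subtype.ext (BrauerDiagram.ext (funext fun x => ?_))
  obtain ⟨y, rfl⟩ : ∃ y, x = Sum.map σ.1 id y := by
    rcases x with x | x
    · exact ⟨.inl (σ.1.symm x), by simp⟩
    · exact ⟨.inr x, rfl⟩
  refine (BrauerDiagram.ofPerm_comp_partner σ.1 (ofPerm τ).1 y).trans ?_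
  rcases y with v | v
  · change Sum.inr (τ.1.symm v) = Sum.inr ((σ.1 * τ.1).symm (σ.1 v))
    congr 1
    rw [Equiv.eq_symm_apply]
    simp
  · rfl

theorem loops_add (d e f : DiagramC r) :
    loops d e + loops (d * e) f = loops e f + loops d (e * f) :=
  BrauerDiagram.loops_add d.1 e.1 f.1

theorem loops_ofPerm_left (σ : Hyperoctahedral r) (d : DiagramC r) : loops (ofPerm σ) d = 0 :=
  BrauerDiagram.loops_ofPerm_left σ.1 d.1

theorem loops_ofPerm_right (d : DiagramC r) (σ : Hyperoctahedral r) : loops d (ofPerm σ) = 0 :=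
  BrauerDiagram.loops_ofPerm_right d.1 σ.1

theorem loops_one_left (d : DiagramC r) : loops 1 d = 0 := BrauerDiagram.loops_ofPerm_left 1 d.1

theorem loops_one_right (d : DiagramC r) : loops d 1 = 0 := BrauerDiagram.loops_ofPerm_right d.1 1

end DiagramC

/-- The Brauer algebra `B(C_r, δ)` of type `C`: the vector space with basis the Brauer diagrams of
type `C_r`, with product `d * e = δ ^ (number of closed loops) • (concatenation of d and e)`. -/
def BrauerC (K : Type*) [Field K] (r : ℕ) (_δ : K) : Type _ := DiagramC r →₀ K

namespace BrauerC

variable {K : Type*} [Field K] {r : ℕ} {δ : K}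

noncomputable instance : AddCommGroup (BrauerC K r δ) :=
  inferInstanceAs (AddCommGroup (DiagramC r →₀ K))

noncomputable instance : Module K (BrauerC K r δ) :=
  inferInstanceAs (Module K (DiagramC r →₀ K))

variable (δ) in
/-- The basis of diagrams. -/
noncomputable def basis : Module.Basis (DiagramC r) K (BrauerC K r δ) := ⟨LinearEquiv.refl K _⟩

variable (K r δ) in
/-- The multiplication of the Brauer algebra of type `C`, as a bilinear map. -/
noncomputable def mulMap : BrauerC K r δ →ₗ[K] BrauerC K r δ →ₗ[K] BrauerC K r δ :=
  (basis δ).constr K fun d => (basis δ).constr K fun e => δ ^ d.loops e • basis δ (d * e)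

noncomputable instance : Mul (BrauerC K r δ) := ⟨fun a b => mulMap K r δ a b⟩

noncomputable instance : One (BrauerC K r δ) := ⟨basis δ 1⟩

theorem mul_def (a b : BrauerC K r δ) : a * b = mulMap K r δ a b := rfl

theorem one_def : (1 : BrauerC K r δ) = basis δ 1 := rfl

theorem basis_mul_basis (d e : DiagramC r) :
    (basis δ d * basis δ e : BrauerC K r δ) = δ ^ d.loops e • basis δ (d * e) := by
  rw [mul_def, mulMap, Module.Basis.constr_basis, Module.Basis.constr_basis]

noncomputable instance : Ring (BrauerC K r δ) where
  __ := (inferInstance : AddCommGroup (BrauerC K r δ))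
  left_distrib a b c := (mulMap K r δ a).map_add b c
  right_distrib a b c := (mulMap K r δ).map_add₂ a b c
  zero_mul a := (mulMap K r δ).map_zero₂ a
  mul_zero a := (mulMap K r δ a).map_zero
  one_mul a := by
    have h : mulMap K r δ 1 = LinearMap.id := (basis δ).ext fun d => by
      rw [← mul_def, one_def, basis_mul_basis, DiagramC.loops_one_left]; simp
    exact congrArg (· a) h
  mul_one a := by
    have h : (mulMap K r δ).flip 1 = LinearMap.id := (basis δ).ext fun d => by
      rw [LinearMap.flip_apply, ← mul_def, one_def, basis_mul_basis, DiagramC.loops_one_right]; simp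
    exact congrArg (· a) h
  mul_assoc a b c := by
    have h : (mulMap K r δ).compr₂ (mulMap K r δ) =
        (LinearMap.lcomp K _ (mulMap K r δ) ∘ₗ LinearMap.llcomp K _ _ _) ∘ₗ mulMap K r δ := by
      refine (basis δ).ext fun d => (basis δ).ext fun e => (basis δ).ext fun f => ?_
      change basis δ d * basis δ e * basis δ f = basis δ d * (basis δ e * basis δ f)
      rw [basis_mul_basis, basis_mul_basis]
      simp only [mul_def, map_smul, LinearMap.smul_apply]
      simp only [← mul_def]
      rw [basis_mul_basis, basis_mul_basis, smul_smul, smul_smul, ← pow_add, ← pow_add,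
        DiagramC.loops_add, mul_assoc]
    exact congrArg (fun F => F a b c) h

noncomputable instance : Algebra K (BrauerC K r δ) :=
  Algebra.ofModule (fun k a b => (mulMap K r δ).map_smul₂ k a b)
    (fun k a b => (mulMap K r δ a).map_smul k b)

end BrauerC

namespace Vertex

/-- `x ↦ ε x` for a sign `ε`. -/
def scale {n : ℕ} (ε : ℤˣ) (x : Vertex n) : Vertex n := (x.1, ε * x.2)

theorem scale_one {n : ℕ} (x : Vertex n) : scale 1 x = x := by simp [scale]

theorem scale_scale {n : ℕ} (ε ε' : ℤˣ) (x : Vertex n) :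
    scale ε (scale ε' x) = scale (ε * ε') x := by simp [scale, mul_assoc]

theorem eq_scale {n : ℕ} (x : Vertex n) : x = scale x.2 (x.1, 1) := by simp [scale]

end Vertex

namespace Hyperoctahedral

variable {n : ℕ}

theorem apply_scale (σ : Hyperoctahedral n) (ε : ℤˣ) (x : Vertex n) :
    σ.1 (x.scale ε) = (σ.1 x).scale ε := by
  rcases Int.units_eq_one_or ε with rfl | rfl
  · simp [Vertex.scale]
  · have h := σ.2 x
    simpa [Vertex.scale, Vertex.neg] using h

theorem apply_fst (σ : Hyperoctahedral n) (x : Vertex n) : (σ.1 x).1 = (σ.1 (x.1, 1)).1 := by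
  conv_lhs => rw [x.eq_scale, apply_scale]
  rfl

theorem apply_snd (σ : Hyperoctahedral n) (x : Vertex n) :
    (σ.1 x).2 = x.2 * (σ.1 (x.1, 1)).2 := by
  conv_lhs => rw [x.eq_scale, apply_scale]
  rfl

/-- The permutation of `{1, …, n}` induced by a signed permutation, `i ↦ |σ i|`. -/
def abs : Hyperoctahedral n →* Equiv.Perm (Fin n) where
  toFun σ :=
    { toFun := fun i => (σ.1 (i, 1)).1
      invFun := fun i => ((σ⁻¹).1 (i, 1)).1
      left_inv := fun i => by
        change ((σ⁻¹).1 ((σ.1 (i, 1)).1, 1)).1 = i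
        rw [← apply_fst]
        simp
      right_inv := fun i => by
        change (σ.1 (((σ⁻¹).1 (i, 1)).1, 1)).1 = i
        rw [← apply_fst]
        simp }
  map_one' := rfl
  map_mul' σ τ := by
    ext i : 1
    change ((σ * τ).1 (i, 1)).1 = (σ.1 ((τ.1 (i, 1)).1, 1)).1
    rw [← apply_fst]
    rfl

theorem abs_apply (σ : Hyperoctahedral n) (i : Fin n) : abs σ i = (σ.1 (i, 1)).1 := rfl

/-- The sign of `σ = ξ σ'`, where `σ'` permutes `{1, …, n}` and `ξ` is a product of `k` sign changes:
`(-1) ^ k * sign σ'`. -/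
def sgn : Hyperoctahedral n →* ℤˣ where
  toFun σ := (∏ i, (σ.1 (i, 1)).2) * Equiv.Perm.sign (abs σ)
  map_one' := by simp
  map_mul' σ τ := by
    have h : ∀ i, ((σ * τ).1 (i, 1)).2 = (τ.1 (i, 1)).2 * (σ.1 (abs τ i, 1)).2 := fun i =>
      apply_snd σ (τ.1 (i, 1))
    simp only [h, map_mul, Finset.prod_mul_distrib,
      Equiv.prod_comp (abs τ) fun i => (σ.1 (i, 1)).2]
    ac_rfl

/-- Given a filling `f` of the set `S` of boxes, the elements `σ` of the hyperoctahedral group which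
permute the entries of each line of `S`, up to signs that lie in `E`. -/
def linePerms (S : Finset (ℕ × ℕ)) (line : ℕ × ℕ → ℕ) (E : Subgroup ℤˣ) (f : S → Vertex n) :
    Subgroup (Hyperoctahedral n) where
  carrier := {σ | ∃ π : Equiv.Perm S, ∀ b, line (π b) = line b ∧
    ∃ ε ∈ E, σ.1 (f b) = (f (π b)).scale ε}
  one_mem' := ⟨1, fun b => ⟨rfl, 1, E.one_mem, by rw [Vertex.scale_one]; rfl⟩⟩
  mul_mem' := by
    rintro σ τ ⟨π, hπ⟩ ⟨π', hπ'⟩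
    refine ⟨π * π', fun b => ⟨(hπ _).1.trans (hπ' b).1, ?_⟩⟩
    obtain ⟨ε', hε', h'⟩ := (hπ' b).2
    obtain ⟨ε, hε, h⟩ := (hπ (π' b)).2
    refine ⟨ε' * ε, E.mul_mem hε' hε, ?_⟩
    change σ.1 (τ.1 (f b)) = _
    rw [h', apply_scale, h, Vertex.scale_scale]
    rfl
  inv_mem' := by
    rintro σ ⟨π, hπ⟩
    refine ⟨π⁻¹, fun b => ?_⟩
    obtain ⟨h1, ε, hε, h⟩ := hπ (π⁻¹ b)
    rw [show π (π⁻¹ b) = b from π.apply_symm_apply b] at h1 h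
    refine ⟨h1.symm, ε⁻¹, E.inv_mem hε, ?_⟩
    change (σ.1)⁻¹ (f b) = _
    rw [Equiv.Perm.inv_eq_iff_eq, apply_scale, h, Vertex.scale_scale, inv_mul_cancel,
      Vertex.scale_one]

theorem mem_linePerms_conj (S : Finset (ℕ × ℕ)) (line : ℕ × ℕ → ℕ) (E : Subgroup ℤˣ)
    (f : S → Vertex n) (σ τ : Hyperoctahedral n) :
    σ ∈ linePerms S line E (fun b => (τ⁻¹).1 (f b)) ↔ τ * σ * τ⁻¹ ∈ linePerms S line E f := by
  refine exists_congr fun π => forall_congr' fun b => and_congr_right fun _ =>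
    exists_congr fun ε => and_congr_right fun _ => ?_
  rw [← apply_scale]
  change _ ↔ τ.1 (σ.1 ((τ⁻¹).1 (f b))) = _
  change _ = (τ.1)⁻¹ _ ↔ _
  rw [Equiv.Perm.eq_inv_iff_eq]

end Hyperoctahedral

/-- A bipartition of `n`: a pair of partitions, given by their Young diagrams, with `n` boxes in
total. -/
@[ext]
structure Bipartition (n : ℕ) where
  left : YoungDiagram
  right : YoungDiagram
  card_add_card : left.card + right.card = n

namespace Bipartition

/-- The dominance order on bipartitions, `lam ⊵ mu`. (The sizes `n` and `n'` are allowed to be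
different variables only in order to avoid casts; the relation is used for `n = n'`.) -/
def Dominates {n n' : ℕ} (lam : Bipartition n) (mu : Bipartition n') : Prop :=
  (∀ j, ∑ i ∈ Finset.range j, mu.left.rowLen i ≤ ∑ i ∈ Finset.range j, lam.left.rowLen i) ∧
  ∀ j, mu.left.card + ∑ i ∈ Finset.range j, mu.right.rowLen i ≤
    lam.left.card + ∑ i ∈ Finset.range j, lam.right.rowLen i

theorem eq_of_sum_rowLen {mu nu : YoungDiagram}
    (h : ∀ j, ∑ i ∈ Finset.range j, mu.rowLen i = ∑ i ∈ Finset.range j, nu.rowLen i) :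
    mu = nu := by
  have h' : ∀ i, mu.rowLen i = nu.rowLen i := fun i => by
    have h1 := h (i + 1)
    rw [Finset.sum_range_succ, Finset.sum_range_succ, h i] at h1
    exact Nat.add_left_cancel h1
  ext ⟨i, j⟩
  rw [YoungDiagram.mem_cells, YoungDiagram.mem_cells, YoungDiagram.mem_iff_lt_rowLen, h',
    ← YoungDiagram.mem_iff_lt_rowLen]

theorem Dominates.antisymm {n : ℕ} {lam mu : Bipartition n} (h : lam.Dominates mu)
    (h' : mu.Dominates lam) : lam = mu := by
  have h1 : lam.left = mu.left := eq_of_sum_rowLen fun j => (h'.1 j).antisymm (h.1 j)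
  have h2 : lam.right = mu.right := eq_of_sum_rowLen fun j => by
    have := (h'.2 j).antisymm (h.2 j)
    rw [h1] at this
    exact Nat.add_left_cancel this
  exact Bipartition.ext h1 h2

end Bipartition

/-- A bitableau of shape `lam`: a filling of the boxes by elements of `{-n, …, -1, 1, …, n}` whose
absolute values are distinct. -/
@[ext]
structure BiTableau {n : ℕ} (lam : Bipartition n) where
  left : lam.left.cells → Vertex n
  right : lam.right.cells → Vertex n
  injective : Function.Injective (Sum.elim (fun b => (left b).1) (fun b => (right b).1))

namespace BiTableau

variable {n : ℕ} {lam : Bipartition n}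

/-- The right action of the hyperoctahedral group on bitableaux. Here `x · σ = σ⁻¹ x` on entries,
which is the vertex of the bottom row that is joined to `x` in the diagram of `σ`. -/
def act (t : BiTableau lam) (σ : Hyperoctahedral n) : BiTableau lam where
  left b := (σ⁻¹).1 (t.left b)
  right b := (σ⁻¹).1 (t.right b)
  injective := by
    have h := (Hyperoctahedral.abs σ⁻¹).injective.comp t.injective
    convert h using 1
    funext b
    rcases b with b | b <;> exact Hyperoctahedral.apply_fst _ _

theorem act_one (t : BiTableau lam) : t.act 1 = t := rfl

theorem act_mul (t : BiTableau lam) (σ τ : Hyperoctahedral n) :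
    t.act (σ * τ) = (t.act σ).act τ := by
  ext1 <;> funext b <;> simp [act]

/-- The row permutations of `t`: they permute the entries of each row, and may change signs of the
entries of the second tableau. -/
def rowGroup (t : BiTableau lam) : Subgroup (Hyperoctahedral n) :=
  Hyperoctahedral.linePerms lam.left.cells Prod.fst ⊥ t.left ⊓
    Hyperoctahedral.linePerms lam.right.cells Prod.fst ⊤ t.right

/-- The column permutations of `t`: they permute the entries of each column, and may change signs of
the entries of the first tableau. -/
def colGroup (t : BiTableau lam) : Subgroup (Hyperoctahedral n) :=
  Hyperoctahedral.linePerms lam.left.cells Prod.snd ⊤ t.left ⊓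
    Hyperoctahedral.linePerms lam.right.cells Prod.snd ⊥ t.right

theorem mem_rowGroup_act (t : BiTableau lam) (σ τ : Hyperoctahedral n) :
    σ ∈ (t.act τ).rowGroup ↔ τ * σ * τ⁻¹ ∈ t.rowGroup :=
  and_congr (Hyperoctahedral.mem_linePerms_conj _ _ _ _ _ _)
    (Hyperoctahedral.mem_linePerms_conj _ _ _ _ _ _)

theorem mem_colGroup_act (t : BiTableau lam) (σ τ : Hyperoctahedral n) :
    σ ∈ (t.act τ).colGroup ↔ τ * σ * τ⁻¹ ∈ t.colGroup :=
  and_congr (Hyperoctahedral.mem_linePerms_conj _ _ _ _ _ _)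
    (Hyperoctahedral.mem_linePerms_conj _ _ _ _ _ _)

/-- Row equivalence of bitableaux. -/
def rowEquiv (lam : Bipartition n) : Setoid (BiTableau lam) where
  r t t' := ∃ σ ∈ t.rowGroup, t' = t.act σ
  iseqv :=
    { refl := fun t => ⟨1, t.rowGroup.one_mem, t.act_one.symm⟩
      symm := by
        rintro t _ ⟨σ, hσ, rfl⟩
        refine ⟨σ⁻¹, ?_, by rw [← act_mul, mul_inv_cancel, act_one]⟩
        rw [mem_rowGroup_act]
        simpa using hσ
      trans := by
        rintro t _ _ ⟨σ, hσ, rfl⟩ ⟨τ, hτ, rfl⟩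
        refine ⟨σ * τ, ?_, (act_mul _ _ _).symm⟩
        rw [mem_rowGroup_act] at hτ
        simpa using t.rowGroup.mul_mem hτ hσ }

end BiTableau

/-- Bitabloids: row equivalence classes of bitableaux. -/
def BiTabloid {n : ℕ} (lam : Bipartition n) : Type := Quotient (BiTableau.rowEquiv lam)

namespace BiTabloid

variable {n : ℕ} {lam : Bipartition n}

/-- The bitabloid of a bitableau. -/
def mk (t : BiTableau lam) : BiTabloid lam := Quotient.mk (BiTableau.rowEquiv lam) t

open MulOpposite in
/-- The right action of the hyperoctahedral group on bitabloids. -/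
instance : MulAction (Hyperoctahedral n)ᵐᵒᵖ (BiTabloid lam) where
  smul σ := Quotient.map (fun t => t.act (unop σ)) (by
    rintro t _ ⟨ρ, hρ, rfl⟩
    refine ⟨(unop σ)⁻¹ * ρ * unop σ, ?_, ?_⟩
    · rw [BiTableau.mem_rowGroup_act]
      simpa [mul_assoc] using hρ
    · rw [← BiTableau.act_mul, ← BiTableau.act_mul]
      congr 1
      group)
  one_smul x := by
    induction x using Quotient.ind with | _ t
    rfl
  mul_smul σ τ x := by
    induction x using Quotient.ind with | _ t
    exact congrArg mk (t.act_mul (unop τ) (unop σ))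

theorem op_smul_mk (σ : Hyperoctahedral n) (t : BiTableau lam) :
    MulOpposite.op σ • mk t = mk (t.act σ) := rfl

end BiTabloid

/-! Right modules over the group algebra of `W_n` are representations of the opposite group. -/

section Specht

variable (K : Type*) [Field K] {n : ℕ}

/-- The permutation module `M(lam)`, with basis the bitabloids. -/
noncomputable def permutationModule (lam : Bipartition n) :
    Representation K (Hyperoctahedral n)ᵐᵒᵖ (BiTabloid lam →₀ K) where
  toFun σ := Finsupp.lmapDomain K K (σ • ·)
  map_one' := Finsupp.lhom_ext fun x a => by simp
  map_mul' σ τ := Finsupp.lhom_ext fun x a => by simp [mul_smul]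

theorem permutationModule_single {lam : Bipartition n} (σ : (Hyperoctahedral n)ᵐᵒᵖ)
    (x : BiTabloid lam) (a : K) :
    permutationModule K lam σ (Finsupp.single x a) = Finsupp.single (σ • x) a :=
  Finsupp.mapDomain_single

open scoped Classical in
/-- The polytabloid `e_t = ∑ σ, sgn σ • {t · σ}`, the sum being over the column permutations. -/
noncomputable def polytabloid {lam : Bipartition n} (t : BiTableau lam) : BiTabloid lam →₀ K :=
  ∑ σ : t.colGroup, Finsupp.single (BiTabloid.mk (t.act σ)) ((Hyperoctahedral.sgn σ.1 : ℤ) : K)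

theorem permutationModule_polytabloid {lam : Bipartition n} (t : BiTableau lam)
    (τ : Hyperoctahedral n) :
    permutationModule K lam (MulOpposite.op τ) (polytabloid K t) = polytabloid K (t.act τ) := by
  classical
  rw [polytabloid, polytabloid, map_sum]
  refine Fintype.sum_equiv
    ((MulAut.conj τ⁻¹).toEquiv.subtypeEquiv fun σ => ?_) _ _ fun σ => ?_
  · rw [BiTableau.mem_colGroup_act]
    simp [mul_assoc]
  · rw [permutationModule_single, BiTabloid.op_smul_mk]
    congr 2
    · rw [← BiTableau.act_mul, ← BiTableau.act_mul]
      simp [mul_assoc]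
    · have h : Hyperoctahedral.sgn (τ⁻¹ * σ.1 * τ) = Hyperoctahedral.sgn σ.1 := by
        rw [map_mul, map_mul, map_inv, mul_comm, mul_inv_cancel_left]
      rw [← h]
      simp

/-- The Specht module inside the permutation module: the span of all polytabloids. -/
noncomputable def spechtSubrepresentation (lam : Bipartition n) :
    Subrepresentation (permutationModule K lam) where
  toSubmodule := Submodule.span K (Set.range (polytabloid K))
  apply_mem_toSubmodule g v hv := by
    induction hv using Submodule.span_induction with
    | mem x hx =>
      obtain ⟨t, rfl⟩ := hx
      exact Submodule.subset_span
        ⟨t.act g.unop, (permutationModule_polytabloid K t g.unop).symm⟩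
    | zero => simp
    | add x y _ _ hx hy => rw [map_add]; exact Submodule.add_mem _ hx hy
    | smul a x _ hx => rw [map_smul]; exact Submodule.smul_mem _ a hx

/-- The Specht module `S(lam)`. -/
noncomputable def spechtModule (lam : Bipartition n) :
    Representation K (Hyperoctahedral n)ᵐᵒᵖ (spechtSubrepresentation K lam).toSubmodule :=
  (spechtSubrepresentation K lam).toRepresentation

/-- The dual Specht module `S'(lam)`, with `(φ · σ) m = φ (m · σ⁻¹)`. -/
noncomputable def dualSpechtModule (lam : Bipartition n) :
    Representation K (Hyperoctahedral n)ᵐᵒᵖ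
      (Module.Dual K (spechtSubrepresentation K lam).toSubmodule) :=
  (spechtModule K lam).dual

end Specht

/-- The index set of the cell modules: the pairs `(l, lam)` with `0 ≤ l ≤ r` and `lam` a bipartition
of `r - l`. -/
@[ext]
structure CellIndex (r : ℕ) where
  layer : ℕ
  layer_le : layer ≤ r
  shape : Bipartition (r - layer)

/-- The order on the index set: `(m, mu) ≥ (l, lam)` if `m < l`, or `m = l` and `lam ⊵ mu`. -/
instance (r : ℕ) : PartialOrder (CellIndex r) where
  le x y := y.layer < x.layer ∨ (x.layer = y.layer ∧ x.shape.Dominates y.shape)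
  le_refl x := .inr ⟨rfl, fun _ => le_rfl, fun _ => le_rfl⟩
  le_trans x y z := by
    rintro (h | ⟨h, h1, h2⟩) (h' | ⟨h', h1', h2'⟩)
    · exact .inl (h'.trans h)
    · exact .inl (h' ▸ h)
    · exact .inl (h ▸ h')
    · exact .inr ⟨h.trans h', fun j => (h1' j).trans (h1 j), fun j => (h2' j).trans (h2 j)⟩
  le_antisymm := by
    rintro ⟨l, hl, lam⟩ ⟨m, hm, mu⟩ (h | ⟨h, h1⟩) (h' | ⟨h', h1'⟩)
    · exact (lt_asymm h h').elim
    · exact (h.ne h').elim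
    · exact (h'.ne h).elim
    · obtain rfl : l = m := h
      obtain rfl := h1.antisymm h1'
      rfl


namespace DiagramC

variable {r : ℕ}

open scoped Classical in
/-- The number of horizontal edges in the top row (which is the number of those in the bottom
row). -/
noncomputable def numArcs (d : DiagramC r) : ℕ :=
  (Finset.univ.filter fun v : Vertex r => ∃ w, d.1.partner (.inl v) = .inl w).card / 2

/-- The diagram with horizontal edges `{-i, i}`, for `1 ≤ i ≤ l`, in both rows, and vertical edges
from `i` to `i` for all other vertices `i`. -/
def arcs (r l : ℕ) : DiagramC r where
  val :=
    { partner := fun x => x.elim (fun v => if v.1.1 < l then .inl v.neg else .inr v)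
        (fun v => if v.1.1 < l then .inr v.neg else .inl v)
      partner_partner := by
        rintro (v | v) <;> by_cases h : v.1.1 < l <;> simp [h, Vertex.neg]
      partner_ne := by
        rintro (v | v) <;> by_cases h : v.1.1 < l <;>
          simp [h, Vertex.neg, Prod.ext_iff, (units_ne_neg_self _).symm] }
  property := by
    rintro (v | v) <;> by_cases h : v.1.1 < l <;> simp [h, Vertex.neg]

end DiagramC

/-- The inclusion of `{±1, …, ±(r - l)}` as the outer vertices `{±(l + 1), …, ±r}` of a row. -/
def Vertex.shift (r l : ℕ) : Vertex (r - l) ↪ Vertex r where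
  toFun x := (⟨x.1.1 + l, by have := x.1.2; omega⟩, x.2)
  inj' := by
    rintro ⟨i, s⟩ ⟨j, t⟩ h
    simp only [Prod.mk.injEq, Fin.mk.injEq, add_left_inj] at h
    exact Prod.ext (Fin.ext h.1) h.2

theorem Vertex.mem_range_shift {r l : ℕ} (x : Vertex r) :
    x ∈ Set.range (Vertex.shift r l) ↔ l ≤ x.1.1 := by
  constructor
  · rintro ⟨y, rfl⟩
    exact Nat.le_add_left _ _
  · intro h
    refine ⟨(⟨x.1.1 - l, by have := x.1.2; omega⟩, x.2), Prod.ext (Fin.ext ?_) rfl⟩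
    exact Nat.sub_add_cancel h

/-- The embedding of `W_{r - l}` into `W_r` as the elements that only move the outer vertices
`±(l + 1), …, ±r`. -/
noncomputable def Hyperoctahedral.extend (r l : ℕ) : Hyperoctahedral (r - l) →* Hyperoctahedral r :=
  ((Equiv.Perm.viaEmbeddingHom (Vertex.shift r l)).comp (Hyperoctahedral (r - l)).subtype).codRestrict
    (Hyperoctahedral r) fun σ x => by
      change σ.1.viaEmbedding (Vertex.shift r l) x.neg = (σ.1.viaEmbedding (Vertex.shift r l) x).neg
      by_cases hx : x ∈ Set.range (Vertex.shift r l)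
      · obtain ⟨y, rfl⟩ := hx
        rw [show (Vertex.shift r l y).neg = Vertex.shift r l y.neg from rfl,
          Equiv.Perm.viaEmbedding_apply, Equiv.Perm.viaEmbedding_apply, σ.2 y]
        rfl
      · rw [Equiv.Perm.viaEmbedding_apply_of_notMem _ _ _ hx,
          Equiv.Perm.viaEmbedding_apply_of_notMem]
        rw [Vertex.mem_range_shift] at hx ⊢
        exact hx

theorem Hyperoctahedral.extend_apply_of_lt {r l : ℕ} (σ : Hyperoctahedral (r - l)) (x : Vertex r)
    (hx : x.1.1 < l) : (extend r l σ).1 x = x :=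
  Equiv.Perm.viaEmbedding_apply_of_notMem _ _ _ (by
    rw [Vertex.mem_range_shift]
    omega)

theorem Hyperoctahedral.le_extend_apply {r l : ℕ} (σ : Hyperoctahedral (r - l)) (x : Vertex r)
    (hx : l ≤ x.1.1) : l ≤ ((extend r l σ).1 x).1.1 := by
  obtain ⟨y, rfl⟩ := (Vertex.mem_range_shift x).2 hx
  change l ≤ (σ.1.viaEmbedding (Vertex.shift r l) _).1.1
  rw [Equiv.Perm.viaEmbedding_apply]
  exact Nat.le_add_left _ _

theorem DiagramC.ofPerm_mul_arcs {r l : ℕ} (σ : Hyperoctahedral (r - l)) :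
    ofPerm (Hyperoctahedral.extend r l σ) * arcs r l =
      arcs r l * ofPerm (Hyperoctahedral.extend r l σ) := by
  set s := Hyperoctahedral.extend r l σ with hs
  have hlt : ∀ x : Vertex r, x.1.1 < l → s.1 x = x := Hyperoctahedral.extend_apply_of_lt σ
  have hge : ∀ x : Vertex r, l ≤ x.1.1 → l ≤ (s.1 x).1.1 := Hyperoctahedral.le_extend_apply σ
  refine Subtype.ext (BrauerDiagram.ext (funext fun x => ?_))
  obtain ⟨y, rfl⟩ : ∃ y, x = Sum.map s.1 id y := by
    rcases x with x | x
    · exact ⟨.inl (s.1.symm x), by simp⟩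
    · exact ⟨.inr x, rfl⟩
  refine (BrauerDiagram.ofPerm_comp_partner s.1 (arcs r l).1 y).trans ?_
  have hA : ∀ y, (arcs r l).1.partner (Sum.map s.1 s.1 y) =
      Sum.map s.1 s.1 ((arcs r l).1.partner y) := by
    rintro (v | v) <;> by_cases hv : v.1.1 < l
    · simp [arcs, hv, hlt v hv, hlt v.neg hv]
    · simp [arcs, hv, (hge v (not_lt.1 hv)).not_gt]
    · simp [arcs, hv, hlt v hv, hlt v.neg hv]
    · simp [arcs, hv, (hge v (not_lt.1 hv)).not_gt]
  have hs : ∀ y : Vertex r ⊕ Vertex r,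
      Sum.map id s.1.symm (Sum.map s.1 s.1 y) = Sum.map s.1 id y := by
    rintro (v | v) <;> simp
  have h2 := BrauerDiagram.comp_ofPerm_partner (arcs r l).1 s.1 (Sum.map s.1 s.1 y)
  rw [hA, hs, hs] at h2
  exact h2.symm

namespace BrauerC

variable (K : Type*) [Field K] (r : ℕ) (δ : K)

/-- The two-sided ideal `J_l` generated by all diagrams with at least `l` horizontal edges. -/
noncomputable def J (l : ℕ) : TwoSidedIdeal (BrauerC K r δ) :=
  TwoSidedIdeal.span {x | ∃ d : DiagramC r, l ≤ d.numArcs ∧ x = basis δ d}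

/-- `J_l` as a right submodule; right modules over `B` are modules over `Bᵐᵒᵖ`. -/
noncomputable def rightJ (l : ℕ) : Submodule (BrauerC K r δ)ᵐᵒᵖ (BrauerC K r δ) where
  carrier := {x | x ∈ J K r δ l}
  add_mem' := (J K r δ l).add_mem
  zero_mem' := (J K r δ l).zero_mem
  smul_mem' b _ hx := (J K r δ l).mul_mem_right _ b.unop hx

/-- The element `e_l`, an idempotent if `δ ≠ 0`. -/
noncomputable def idem (l : ℕ) : BrauerC K r δ := (δ ^ l)⁻¹ • basis δ (DiagramC.arcs r l)

/-- Left multiplication by `b` on `B / J_l`. -/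
noncomputable def leftMul (l : ℕ) (b : BrauerC K r δ) :
    BrauerC K r δ ⧸ rightJ K r δ l →ₗ[(BrauerC K r δ)ᵐᵒᵖ] BrauerC K r δ ⧸ rightJ K r δ l :=
  (rightJ K r δ l).mapQ (rightJ K r δ l)
    { toFun := fun x => b * x
      map_add' := mul_add b
      map_smul' := fun c x => (mul_assoc b x c.unop).symm }
    fun x hx => (J K r δ l).mul_mem_left b x hx

/-- The right `B`-module `e_l (B / J_{l+1})`, as a submodule of `B / J_{l+1}`. -/
noncomputable def layerModule (l : ℕ) :
    Submodule (BrauerC K r δ)ᵐᵒᵖ (BrauerC K r δ ⧸ rightJ K r δ (l + 1)) :=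
  LinearMap.range (leftMul K r δ (l + 1) (idem K r δ l))

/-- The image of an element of `W_{r - l}` in `B`, acting on the outer vertices. -/
noncomputable def ofHyperoctahedral (l : ℕ) (σ : Hyperoctahedral (r - l)) : BrauerC K r δ :=
  basis δ (DiagramC.ofPerm (Hyperoctahedral.extend r l σ))

theorem ofHyperoctahedral_mul (l : ℕ) (σ τ : Hyperoctahedral (r - l)) :
    ofHyperoctahedral K r δ l (σ * τ) =
      ofHyperoctahedral K r δ l σ * ofHyperoctahedral K r δ l τ := by
  rw [ofHyperoctahedral, ofHyperoctahedral, ofHyperoctahedral, basis_mul_basis,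
    DiagramC.loops_ofPerm_left, DiagramC.ofPerm_mul, map_mul, pow_zero, one_smul]

theorem ofHyperoctahedral_mul_idem (l : ℕ) (σ : Hyperoctahedral (r - l)) :
    ofHyperoctahedral K r δ l σ * idem K r δ l = idem K r δ l * ofHyperoctahedral K r δ l σ := by
  rw [idem, mul_smul_comm, smul_mul_assoc, ofHyperoctahedral, basis_mul_basis, basis_mul_basis,
    DiagramC.ofPerm_mul_arcs, DiagramC.loops_ofPerm_left, DiagramC.loops_ofPerm_right]

/-- The right `B`-module `e_l (B / J_{l+1})`, as a type. -/
def Layer (l : ℕ) : Type _ := layerModule K r δ l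

noncomputable instance (l : ℕ) : AddCommGroup (Layer K r δ l) :=
  inferInstanceAs (AddCommGroup (layerModule K r δ l))

noncomputable instance (l : ℕ) : Module (BrauerC K r δ)ᵐᵒᵖ (Layer K r δ l) :=
  inferInstanceAs (Module (BrauerC K r δ)ᵐᵒᵖ (layerModule K r δ l))

noncomputable instance (l : ℕ) : Module K (Layer K r δ l) :=
  inferInstanceAs (Module K (layerModule K r δ l))

instance (l : ℕ) : IsScalarTower K (BrauerC K r δ)ᵐᵒᵖ (Layer K r δ l) :=
  inferInstanceAs (IsScalarTower K (BrauerC K r δ)ᵐᵒᵖ (layerModule K r δ l))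

instance (l : ℕ) : SMulCommClass K (BrauerC K r δ)ᵐᵒᵖ (Layer K r δ l) :=
  inferInstanceAs (SMulCommClass K (BrauerC K r δ)ᵐᵒᵖ (layerModule K r δ l))

/-- The left action of `W_{r - l}` on `e_l (B / J_{l+1})`: as `W_{r - l}` commutes with `e_l`, it is
given by left multiplication. It commutes with the right action of `B`. -/
noncomputable def layerAct (l : ℕ) (σ : Hyperoctahedral (r - l)) :
    Layer K r δ l →ₗ[(BrauerC K r δ)ᵐᵒᵖ] Layer K r δ l :=
  (leftMul K r δ (l + 1) (ofHyperoctahedral K r δ l σ)).restrict (by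
    rintro _ ⟨x, rfl⟩
    induction x using Submodule.Quotient.induction_on with | _ x
    refine ⟨Submodule.Quotient.mk (ofHyperoctahedral K r δ l σ * x), ?_⟩
    refine congrArg (Submodule.Quotient.mk (p := rightJ K r δ (l + 1))) ?_
    change idem K r δ l * (ofHyperoctahedral K r δ l σ * x) =
      ofHyperoctahedral K r δ l σ * (idem K r δ l * x)
    rw [← mul_assoc, ← mul_assoc, ofHyperoctahedral_mul_idem])

section ind

variable {r}
open scoped TensorProduct

/-- The relations `(v · σ) ⊗ x = v ⊗ σ x` (with the two factors interchanged), which define the tensor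
product over the group algebra of `W_{r - l}` as a quotient of the tensor product over `K`. Their
span over `K` is stable under `B`, so it does not matter that the span is taken over `B`. -/
noncomputable def balanced (l : ℕ) {V : Type*} [AddCommGroup V] [Module K V]
    (ρ : Representation K (Hyperoctahedral (r - l))ᵐᵒᵖ V) :
    Submodule (BrauerC K r δ)ᵐᵒᵖ (Layer K r δ l ⊗[K] V) :=
  Submodule.span _ {z | ∃ x v σ, z = x ⊗ₜ[K] ρ (MulOpposite.op σ) v - layerAct K r δ l σ x ⊗ₜ[K] v}

/-- The right `B`-module `ind_l V = V ⊗ e_l (B / J_{l+1})`, the tensor product being over the group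
algebra of `W_{r - l}`, for a right module `V` over this group algebra. (The factors are written in
the opposite order, so that `B` acts on the first one.) -/
abbrev ind (l : ℕ) {V : Type*} [AddCommGroup V] [Module K V]
    (ρ : Representation K (Hyperoctahedral (r - l))ᵐᵒᵖ V) : Type _ :=
  (Layer K r δ l ⊗[K] V) ⧸ balanced K δ l ρ

end ind

end BrauerC

/-- The cell module `ind_l S'(lam)` of `B(C_r, δ)`. -/
abbrev CellModule (K : Type*) [Field K] {r : ℕ} (δ : K) (x : CellIndex r) : Type _ :=
  BrauerC.ind K δ x.layer (dualSpechtModule K x.shape)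

/-! The elements `v ⊗ e_l` generate `ind_l V` over `B`, and the diagram `arcs r l` acts on them as a
nonzero scalar. So a homomorphism `f` out of `ind_l V` is determined by the vectors `f (v ⊗ e_l)`,
which are multiples of their own images under `arcs r l`.

If `m < l`, then `arcs r l` lies in `J_{m+1}`. This ideal annihilates `ind_m W`, so `f = 0`
(`ind_hom_eq_zero_of_lt`).

If `m = l`, then `arcs r l` maps `ind_l W` into the vectors `w ⊗ e_l`. Indeed, modulo `J_{l+1}`, a
product `arcs * d * arcs` is zero or a scalar times `arcs * σ` with `σ ∈ W_{r-l}`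
(`op_arcs_smul_mem_range`). The map `w ↦ w ⊗ e_l` is injective, because reading off the coefficients
of the diagrams `arcs * σ` recovers `w` up to the factor `δ ^ (-l)` (`fromInd_toInd`). Hence `f`
comes from a `W_{r-l}`-homomorphism `F : V → W` (`ind_hom_eq_zero`), and it remains to show that `F
: S'(lam) → S'(mu)` vanishes when `lam` strictly dominates `mu`.

For this, `S'(lam)` is spanned by the coefficient functionals of bitabloids `{s}`, and an element of
`S'(mu)` is determined by its values on polytabloids `e_t`. The pairing of `s` and `t` given by `F`
is invariant under the simultaneous action of the group. As `char K ≠ 2`, it vanishes as soon as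
some group element fixes one side and negates the other. Sign changes show that a nonzero pairing
forces the first components of `s` and `t` to have the same absolute values. Signed transpositions
show that no two entries lie in one row of `s` and in one column of `t`. As in the classical
argument for symmetric groups, this forces `mu` to dominate `lam` (`dominates_of_apply_ne_zero`),
contradicting strictness. -/

namespace YoungDiagram

/-! ### Dominance from a rearrangement of boxes -/

theorem card_filter_fst_lt (mu : YoungDiagram) (j : ℕ) :
    (mu.cells.filter (·.1 < j)).card = ∑ i ∈ Finset.range j, mu.rowLen i := by
  rw [Finset.card_eq_sum_card_fiberwise (f := Prod.fst) (t := Finset.range j)]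
  · refine Finset.sum_congr rfl fun i hi => ?_
    rw [rowLen_eq_card, row, Finset.filter_filter]
    congr 1
    refine Finset.filter_congr fun x _ => ?_
    simp only [Finset.mem_range] at hi
    constructor
    · exact fun h => h.2
    · rintro rfl
      exact ⟨hi, rfl⟩
  · intro x hx
    simpa using (Finset.mem_filter.1 hx).2

/-- If the boxes of `mu` can be moved injectively to boxes of `nu` so that boxes of the same row go
to different columns, then `nu` dominates `mu`. -/
theorem sum_rowLen_le_of_map {mu nu : YoungDiagram} (φ : mu.cells → nu.cells)
    (hφ : Function.Injective φ)
    (h : ∀ p q : mu.cells, p.1.1 = q.1.1 → (φ p).1.2 = (φ q).1.2 → p = q) (j : ℕ) :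
    ∑ i ∈ Finset.range j, mu.rowLen i ≤ ∑ i ∈ Finset.range j, nu.rowLen i := by
  classical
  rw [← card_filter_fst_lt, ← card_filter_fst_lt]
  set A : Finset mu.cells := Finset.univ.filter (·.1.1 < j) with hA
  have hcard : (mu.cells.filter (·.1 < j)).card = A.card := by
    rw [hA, ← Finset.card_map (Function.Embedding.subtype _)]
    congr 1
    ext x
    simp
    tauto
  -- Both sides are sorted by the columns `c` of `nu`. Column `c` has `min j (colLen c)` boxes in
  -- the first `j` rows, and it receives at most one box from each of the first `j` rows of `mu` and
  -- at most `colLen c` boxes in all.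
  rw [hcard, Finset.card_eq_sum_card_fiberwise (f := fun p => (φ p).1.2)
    (t := nu.cells.image Prod.snd), Finset.card_eq_sum_card_fiberwise (f := Prod.snd)
    (t := nu.cells.image Prod.snd)]
  · refine Finset.sum_le_sum fun c _ => ?_
    have hfib : ((nu.cells.filter (·.1 < j)).filter (·.2 = c)).card = min j (nu.colLen c) := by
      rw [← Finset.card_range (min j (nu.colLen c)),
        ← Finset.card_map (⟨fun i => (i, c), fun a b h => (Prod.ext_iff.1 h).1⟩ : ℕ ↪ ℕ × ℕ)]
      congr 1
      ext ⟨a, b⟩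
      simp only [Finset.mem_filter, YoungDiagram.mem_cells, Finset.mem_map, Finset.mem_range,
        lt_min_iff]
      constructor
      · rintro ⟨⟨h1, h2⟩, rfl⟩
        exact ⟨a, ⟨h2, mem_iff_lt_colLen.1 h1⟩, rfl⟩
      · rintro ⟨a, ⟨h2, h1⟩, h⟩
        obtain ⟨rfl, rfl⟩ := Prod.mk.inj h
        exact ⟨⟨mem_iff_lt_colLen.2 h1, h2⟩, rfl⟩
    rw [hfib]
    refine le_min ?_ ?_
    · rw [← Finset.card_range j]
      refine Finset.card_le_card_of_injOn (fun p => p.1.1) ?_ ?_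
      · intro p hp
        simp only [hA, Finset.coe_filter, Finset.mem_filter, Finset.mem_univ, true_and,
          Set.mem_ofPred_eq] at hp
        simpa using hp.1
      · intro p hp q hq hpq
        simp only [hA, Finset.coe_filter, Finset.mem_filter, Finset.mem_univ, true_and,
          Set.mem_ofPred_eq] at hp hq
        exact h p q hpq (hp.2.trans hq.2.symm)
    · rw [colLen_eq_card]
      refine Finset.card_le_card_of_injOn (fun p => (φ p).1) ?_ ?_
      · intro p hp
        simp only [hA, Finset.coe_filter, Finset.mem_filter, Finset.mem_univ, true_and,
          Set.mem_ofPred_eq] at hp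
        exact mem_col_iff.2 ⟨(φ p).2, hp.2⟩
      · intro p _ q _ hpq
        exact hφ (Subtype.ext hpq)
  · intro x hx
    exact Finset.mem_coe.2 (Finset.mem_image_of_mem _ (Finset.mem_filter.1 hx).1)
  · intro x _
    exact Finset.mem_coe.2 (Finset.mem_image_of_mem _ (φ x).2)

end YoungDiagram

/-! ### Odd elements of the hyperoctahedral group: sign changes and signed transpositions -/

theorem Vertex.exists_eq_scale {n : ℕ} {v w : Vertex n} (h : v.1 = w.1) :
    ∃ ε, v = w.scale ε :=
  ⟨v.2 * w.2, Prod.ext h (by simp [Vertex.scale, mul_assoc])⟩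

namespace Hyperoctahedral

variable {n : ℕ}

/-- The element that changes the sign of `±i`. -/
def signChange (i : Fin n) : Hyperoctahedral n where
  val := Function.Involutive.toPerm (fun x => if x.1 = i then x.neg else x) (by
    intro x
    by_cases h : x.1 = i
    · simp only [h, if_true]
      rw [if_pos (show x.neg.1 = i from h), Vertex.neg_neg]
    · simp [h])
  property x := by
    change (if x.1 = i then x.neg.neg else x.neg) = (if x.1 = i then x.neg else x).neg
    split_ifs <;> rfl

theorem signChange_apply (i : Fin n) (x : Vertex n) :
    (signChange i).1 x = if x.1 = i then x.neg else x := rfl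

theorem sgn_signChange (i : Fin n) : sgn (signChange i) = -1 := by
  have h1 : abs (signChange i) = 1 := by
    ext j : 1
    rw [abs_apply, signChange_apply]
    split_ifs <;> rfl
  change (∏ j, ((signChange i).1 (j, 1)).2) * Equiv.Perm.sign (abs (signChange i)) = -1
  rw [h1, Equiv.Perm.sign_one, mul_one, Finset.prod_eq_single i]
  · simp [signChange_apply, Vertex.neg]
  · intro j _ hj
    simp [signChange_apply, hj]
  · simp

theorem signChange_mem_top {S : Finset (ℕ × ℕ)} (line : ℕ × ℕ → ℕ) (f : S → Vertex n)
    (i : Fin n) : signChange i ∈ linePerms S line ⊤ f := by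
  refine ⟨1, fun b => ⟨rfl, ?_⟩⟩
  rw [signChange_apply]
  obtain ⟨ε, hε⟩ := Vertex.exists_eq_scale
    (v := if (f b).1 = i then (f b).neg else f b) (w := f b) (by split_ifs <;> rfl)
  exact ⟨ε, Subgroup.mem_top _, hε⟩

theorem signChange_mem_of_ne {S : Finset (ℕ × ℕ)} (line : ℕ × ℕ → ℕ) (E : Subgroup ℤˣ)
    {f : S → Vertex n} {i : Fin n} (hi : ∀ b, (f b).1 ≠ i) :
    signChange i ∈ linePerms S line E f := by
  refine ⟨1, fun b => ⟨rfl, 1, E.one_mem, ?_⟩⟩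
  rw [signChange_apply, if_neg (hi b), Vertex.scale_one]
  rfl

/-- The element that interchanges `a` and `b`. -/
def signedSwap (a b : Vertex n) (hab : a.1 ≠ b.1) : Hyperoctahedral n where
  val := Function.Involutive.toPerm (fun x => if x.1 = a.1 then (b.1, x.2 * (a.2 * b.2)) else
      if x.1 = b.1 then (a.1, x.2 * (a.2 * b.2)) else x) (by
    have h : (a.2 * b.2) * (a.2 * b.2) = 1 := Int.units_mul_self _
    intro x
    by_cases h1 : x.1 = a.1
    · simp only [h1, if_true, hab.symm, if_false, mul_assoc, h]
      exact Prod.ext h1.symm (by simp)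
    · by_cases h2 : x.1 = b.1
      · simp only [h2, hab.symm, if_true, if_false, mul_assoc, h]
        exact Prod.ext h2.symm (by simp)
      · simp [h1, h2])
  property x := by
    change (if x.1 = a.1 then (b.1, -x.2 * (a.2 * b.2)) else
      if x.1 = b.1 then (a.1, -x.2 * (a.2 * b.2)) else x.neg) =
      Vertex.neg (if x.1 = a.1 then (b.1, x.2 * (a.2 * b.2)) else
      if x.1 = b.1 then (a.1, x.2 * (a.2 * b.2)) else x)
    split_ifs <;> simp [Vertex.neg]

theorem signedSwap_apply (a b : Vertex n) (hab : a.1 ≠ b.1) (x : Vertex n) :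
    (signedSwap a b hab).1 x = if x.1 = a.1 then (b.1, x.2 * (a.2 * b.2)) else
      if x.1 = b.1 then (a.1, x.2 * (a.2 * b.2)) else x := rfl

theorem signedSwap_left (a b : Vertex n) (hab : a.1 ≠ b.1) : (signedSwap a b hab).1 a = b := by
  rw [signedSwap_apply, if_pos rfl, ← mul_assoc, Int.units_mul_self, one_mul]

theorem signedSwap_right (a b : Vertex n) (hab : a.1 ≠ b.1) : (signedSwap a b hab).1 b = a := by
  rw [signedSwap_apply, if_neg hab.symm, if_pos rfl, mul_left_comm, Int.units_mul_self, mul_one]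

theorem signedSwap_of_ne (a b : Vertex n) (hab : a.1 ≠ b.1) {x : Vertex n} (ha : x.1 ≠ a.1)
    (hb : x.1 ≠ b.1) : (signedSwap a b hab).1 x = x := by
  rw [signedSwap_apply, if_neg ha, if_neg hb]

/-- The factor `a.2 * b.2` occurs at both indices and cancels, so only the sign of the underlying
transposition remains, whatever the signs of `a` and `b` are. -/
theorem sgn_signedSwap (a b : Vertex n) (hab : a.1 ≠ b.1) : sgn (signedSwap a b hab) = -1 := by
  have h1 : abs (signedSwap a b hab) = Equiv.swap a.1 b.1 := by
    ext j : 1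
    rw [abs_apply, signedSwap_apply, Equiv.swap_apply_def]
    split_ifs <;> rfl
  have h2 : ∀ j, ((signedSwap a b hab).1 (j, 1)).2 =
      (if j = a.1 then a.2 * b.2 else 1) * if j = b.1 then a.2 * b.2 else 1 := by
    intro j
    rw [signedSwap_apply]
    by_cases h1 : j = a.1
    · simp [h1, hab]
    · by_cases h2 : j = b.1 <;> simp [h1, h2, hab.symm]
  change (∏ j, ((signedSwap a b hab).1 (j, 1)).2) * Equiv.Perm.sign (abs _) = -1
  rw [h1, Equiv.Perm.sign_swap hab, Finset.prod_congr rfl fun j _ => h2 j,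
    Finset.prod_mul_distrib, Finset.prod_ite_eq', Finset.prod_ite_eq']
  simp only [Finset.mem_univ, if_true, Int.units_mul_self, one_mul]

/-- The vertices `a` and `b` need only be entries of the line up to signs in `E`. Thus one element
can serve two fillings whose entries agree only in absolute value: exactly for one of them, and up
to sign for the one where signs are free. -/
theorem signedSwap_mem {S : Finset (ℕ × ℕ)} (line : ℕ × ℕ → ℕ) (E : Subgroup ℤˣ)
    {f : S → Vertex n} (hf : Function.Injective fun b => (f b).1) {p q : S}
    (hpq : line p = line q) {ε ε' : ℤˣ} (hε : ε ∈ E) (hε' : ε' ∈ E)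
    {a b : Vertex n} (ha : a = (f p).scale ε) (hb : b = (f q).scale ε') (hab : a.1 ≠ b.1) :
    signedSwap a b hab ∈ linePerms S line E f := by
  classical
  have hp : f p = a.scale ε := by
    rw [ha, Vertex.scale_scale, Int.units_mul_self, Vertex.scale_one]
  have hq : f q = b.scale ε' := by
    rw [hb, Vertex.scale_scale, Int.units_mul_self, Vertex.scale_one]
  refine ⟨Equiv.swap p q, fun c => ?_⟩
  by_cases hcp : c = p
  · subst hcp
    rw [Equiv.swap_apply_left]
    refine ⟨hpq.symm, ε * ε', E.mul_mem hε hε', ?_⟩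
    rw [hp, apply_scale, signedSwap_left, hb, Vertex.scale_scale]
  · by_cases hcq : c = q
    · subst hcq
      rw [Equiv.swap_apply_right]
      refine ⟨hpq, ε' * ε, E.mul_mem hε' hε, ?_⟩
      rw [hq, apply_scale, signedSwap_right, ha, Vertex.scale_scale]
    · rw [Equiv.swap_apply_of_ne_of_ne hcp hcq]
      refine ⟨rfl, 1, E.one_mem, ?_⟩
      rw [Vertex.scale_one]
      apply signedSwap_of_ne
      · rw [ha]
        exact fun h => hcp (hf h)
      · rw [hb]
        exact fun h => hcq (hf h)

theorem signedSwap_mem_of_ne {S : Finset (ℕ × ℕ)} (line : ℕ × ℕ → ℕ) (E : Subgroup ℤˣ)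
    {f : S → Vertex n} {a b : Vertex n} (hab : a.1 ≠ b.1) (ha : ∀ c, (f c).1 ≠ a.1)
    (hb : ∀ c, (f c).1 ≠ b.1) : signedSwap a b hab ∈ linePerms S line E f := by
  refine ⟨1, fun c => ⟨rfl, 1, E.one_mem, ?_⟩⟩
  rw [signedSwap_of_ne _ _ _ (ha c) (hb c), Vertex.scale_one]
  rfl

/-- A permutation of the lines of a filling preserves the set of absolute values of the entries. -/
theorem exists_inv_apply_eq {S : Finset (ℕ × ℕ)} {line : ℕ × ℕ → ℕ} {E : Subgroup ℤˣ}
    {f : S → Vertex n} {σ : Hyperoctahedral n} (hσ : σ ∈ linePerms S line E f) (i : Fin n) :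
    (∃ b, ((σ⁻¹).1 (f b)).1 = i) ↔ ∃ b, (f b).1 = i := by
  obtain ⟨π, hπ⟩ := (linePerms S line E f).inv_mem hσ
  have h : ∀ b, ((σ⁻¹).1 (f b)).1 = (f (π b)).1 := fun b => by
    obtain ⟨-, ε, -, h⟩ := hπ b
    rw [h]
    rfl
  simp only [h]
  exact π.surjective.exists (p := fun b => (f b).1 = i) |>.symm

end Hyperoctahedral

/-! ### Entries of bitableaux under row and column permutations -/

namespace BiTableau

open Hyperoctahedral

variable {n : ℕ} {lam mu : Bipartition n}

instance : Finite (BiTableau lam) :=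
  Finite.of_injective (fun t : BiTableau lam => (t.left, t.right)) fun t t' h => by
    rw [Prod.mk.injEq] at h
    exact BiTableau.ext h.1 h.2

theorem left_injective (t : BiTableau lam) : Function.Injective fun b => (t.left b).1 :=
  t.injective.comp Sum.inl_injective

theorem right_injective (t : BiTableau lam) : Function.Injective fun b => (t.right b).1 :=
  t.injective.comp Sum.inr_injective

theorem left_ne_right (t : BiTableau lam) (b : lam.left.cells) (c : lam.right.cells) :
    (t.left b).1 ≠ (t.right c).1 := fun h => Sum.inl_ne_inr (t.injective h)

/-- There are `n` boxes with distinct absolute values, so every absolute value occurs. -/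
theorem exists_left_or_right (t : BiTableau lam) (i : Fin n) :
    (∃ b, (t.left b).1 = i) ∨ ∃ b, (t.right b).1 = i := by
  have hb := (Fintype.bijective_iff_injective_and_card _).2 ⟨t.injective, by
    rw [Fintype.card_sum, Fintype.card_coe, Fintype.card_coe, Fintype.card_fin]
    exact lam.card_add_card⟩
  obtain ⟨b | b, h⟩ := hb.2 i
  · exact .inl ⟨b, h⟩
  · exact .inr ⟨b, h⟩

theorem signChange_mem_rowGroup (t : BiTableau lam) (b : lam.right.cells) :
    signChange (t.right b).1 ∈ t.rowGroup :=
  ⟨signChange_mem_of_ne _ _ fun c => t.left_ne_right c b, signChange_mem_top _ _ _⟩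

theorem signChange_mem_colGroup (t : BiTableau lam) (b : lam.left.cells) :
    signChange (t.left b).1 ∈ t.colGroup :=
  ⟨signChange_mem_top _ _ _, signChange_mem_of_ne _ _ fun c => (t.left_ne_right b c).symm⟩

theorem exists_act_right_of_mem_rowGroup (t : BiTableau lam) {σ : Hyperoctahedral n}
    (hσ : σ ∈ t.rowGroup) (i : Fin n) :
    (∃ b, ((t.act σ).right b).1 = i) ↔ ∃ b, (t.right b).1 = i :=
  exists_inv_apply_eq hσ.2 i

theorem exists_act_right_of_mem_colGroup (t : BiTableau lam) {σ : Hyperoctahedral n}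
    (hσ : σ ∈ t.colGroup) (i : Fin n) :
    (∃ b, ((t.act σ).right b).1 = i) ↔ ∃ b, (t.right b).1 = i :=
  exists_inv_apply_eq hσ.2 i

end BiTableau

/-! ### Homomorphisms between dual Specht modules -/

section SpechtHom

open Hyperoctahedral MulOpposite

variable (K : Type*) [Field K] {n : ℕ} {lam mu : Bipartition n}

instance : Finite (BiTabloid lam) := inferInstanceAs (Finite (Quotient _))

theorem BiTabloid.mk_act_of_mem (t : BiTableau lam) {σ : Hyperoctahedral n}
    (hσ : σ ∈ t.rowGroup) : BiTabloid.mk (t.act σ) = BiTabloid.mk t :=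
  (Quotient.sound (⟨σ, hσ, rfl⟩ : (BiTableau.rowEquiv lam) t (t.act σ))).symm

theorem BiTabloid.exists_right_of_mk_eq {s t : BiTableau lam}
    (h : BiTabloid.mk s = BiTabloid.mk t) (i : Fin n) :
    (∃ b, (t.right b).1 = i) ↔ ∃ b, (s.right b).1 = i := by
  obtain ⟨σ, hσ, rfl⟩ := Quotient.exact h
  exact s.exists_act_right_of_mem_rowGroup hσ i

/-- Substituting `σ ↦ τ * σ` carries the sum over the column group of `t.act τ` to the one over the
column group of `t`, at the cost of the factor `sgn τ`. -/
theorem polytabloid_act_of_mem_colGroup (t : BiTableau lam) {τ : Hyperoctahedral n}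
    (hτ : τ ∈ t.colGroup) :
    polytabloid K (t.act τ) = ((sgn τ : ℤ) : K) • polytabloid K t := by
  classical
  rw [polytabloid, polytabloid, Finset.smul_sum]
  refine Fintype.sum_equiv ((Equiv.mulLeft τ).subtypeEquiv fun σ => ?_) _ _ fun σ => ?_
  · rw [BiTableau.mem_colGroup_act]
    exact t.colGroup.mul_mem_cancel_right (t.colGroup.inv_mem hτ)
  rw [Finsupp.smul_single, ← BiTableau.act_mul]
  change Finsupp.single _ _ =
    Finsupp.single (BiTabloid.mk (t.act (τ * σ.1))) (_ * ((sgn (τ * σ.1) : ℤ) : K))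
  congr 1
  · rw [map_mul, ← Int.cast_mul, ← Units.val_mul, ← mul_assoc, Int.units_mul_self, one_mul]

/-- Column permutations keep the set of absolute values of the second tableau. So in every bitabloid
of the sum the changed entry still lies in the second tableau, where row equivalence ignores signs.
-/
theorem polytabloid_act_signChange_right (t : BiTableau lam) (b : lam.right.cells) :
    polytabloid K (t.act (signChange (t.right b).1)) = polytabloid K t := by
  classical
  rw [← permutationModule_polytabloid, polytabloid, map_sum]
  refine Finset.sum_congr rfl fun σ _ => ?_
  rw [permutationModule_single, BiTabloid.op_smul_mk]
  congr 1
  obtain ⟨c, hc⟩ := (t.exists_act_right_of_mem_colGroup σ.2 (t.right b).1).2 ⟨b, rfl⟩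
  rw [← hc]
  exact BiTabloid.mk_act_of_mem _ ((t.act σ.1).signChange_mem_rowGroup c)

/-- All bitabloids occurring in `e_t` have the absolute values of the second component of `t` in
their second component, which excludes `{s}`. -/
theorem polytabloid_apply_eq_zero (s t : BiTableau lam) (b : lam.left.cells)
    (c : lam.right.cells) (h : (s.left b).1 = (t.right c).1) :
    polytabloid K t (BiTabloid.mk s) = 0 := by
  classical
  rw [polytabloid, Finsupp.finsetSum_apply]
  refine Finset.sum_eq_zero fun σ _ => Finsupp.single_eq_of_ne fun hs => ?_
  obtain ⟨d, hd⟩ := (BiTabloid.exists_right_of_mk_eq hs _).1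
    ((t.exists_act_right_of_mem_colGroup σ.2 (t.right c).1).2 ⟨c, rfl⟩)
  exact s.left_ne_right b d (h.trans hd.symm)

/-- A polytabloid as an element of the Specht module. -/
noncomputable def spechtPolytabloid (t : BiTableau lam) :
    (spechtSubrepresentation K lam).toSubmodule :=
  ⟨polytabloid K t, Submodule.subset_span ⟨t, rfl⟩⟩

/-- The coefficient of a bitabloid, as an element of the dual Specht module. -/
noncomputable def coefficient (s : BiTableau lam) :
    Module.Dual K (spechtSubrepresentation K lam).toSubmodule :=
  Finsupp.lapply (BiTabloid.mk s) ∘ₗ Submodule.subtype _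

theorem coefficient_apply (s : BiTableau lam)
    (x : (spechtSubrepresentation K lam).toSubmodule) :
    coefficient K s x = x.1 (BiTabloid.mk s) := rfl

/-- The polytabloids span the Specht module by definition. -/
theorem dualSpecht_ext {φ ψ : Module.Dual K (spechtSubrepresentation K lam).toSubmodule}
    (h : ∀ t, φ (spechtPolytabloid K t) = ψ (spechtPolytabloid K t)) : φ = ψ := by
  refine LinearMap.ext fun x => ?_
  obtain ⟨x, hx⟩ := x
  induction hx using Submodule.span_induction with
  | mem x hx =>
    obtain ⟨t, rfl⟩ := hx
    exact h t
  | zero => exact (map_zero φ).trans (map_zero ψ).symm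
  | add x y hx hy h1 h2 =>
    exact (map_add φ ⟨x, hx⟩ ⟨y, hy⟩).trans ((congrArg₂ (· + ·) h1 h2).trans
      (map_add ψ ⟨x, hx⟩ ⟨y, hy⟩).symm)
  | smul a x hx h1 =>
    exact (map_smul φ a ⟨x, hx⟩).trans ((congrArg (a • ·) h1).trans (map_smul ψ a ⟨x, hx⟩).symm)

theorem span_coefficient :
    Submodule.span K (Set.range (coefficient K (lam := lam))) = ⊤ := by
  classical
  cases nonempty_fintype (BiTabloid lam)
  rw [eq_top_iff]
  rintro φ -
  -- A functional on the Specht module extends to the permutation module, where it is a combination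
  -- of the coordinate functionals of the finitely many bitabloids.
  obtain ⟨g, rfl⟩ := LinearMap.exists_extend φ
  have hg : g ∘ₗ Submodule.subtype (spechtSubrepresentation K lam).toSubmodule =
      ∑ x : BiTabloid lam, g (Finsupp.single x 1) •
        (Finsupp.lapply x ∘ₗ Submodule.subtype (spechtSubrepresentation K lam).toSubmodule) := by
    refine LinearMap.ext fun v => ?_
    have hv : v.1 = ∑ x : BiTabloid lam, v.1 x • Finsupp.single x (1 : K) := by
      ext y
      simp
    rw [LinearMap.comp_apply, Submodule.subtype_apply, hv, map_sum, LinearMap.sum_apply]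
    refine Finset.sum_congr rfl fun x _ => ?_
    rw [map_smul, smul_eq_mul, mul_comm]
    rfl
  rw [hg]
  refine Submodule.sum_mem _ fun x _ => Submodule.smul_mem _ _ ?_
  induction x using Quotient.ind with | _ s
  exact Submodule.subset_span ⟨s, rfl⟩

theorem dualSpechtModule_apply (φ : Module.Dual K (spechtSubrepresentation K lam).toSubmodule)
    (σ : Hyperoctahedral n) (t : BiTableau lam) :
    dualSpechtModule K lam (op σ) φ (spechtPolytabloid K (t.act σ)) =
      φ (spechtPolytabloid K t) := by
  change φ (spechtModule K lam (op σ)⁻¹ (spechtPolytabloid K (t.act σ))) = _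
  congr 1
  apply Subtype.ext
  change permutationModule K lam (op σ)⁻¹ (polytabloid K (t.act σ)) = polytabloid K t
  rw [← op_inv, permutationModule_polytabloid, ← BiTableau.act_mul, mul_inv_cancel,
    BiTableau.act_one]

theorem dualSpechtModule_coefficient (s : BiTableau lam) (σ : Hyperoctahedral n) :
    dualSpechtModule K lam (op σ) (coefficient K s) = coefficient K (s.act σ) := by
  refine LinearMap.ext fun x => ?_
  change permutationModule K lam (op σ)⁻¹ x.1 (BiTabloid.mk s) = x.1 (BiTabloid.mk (s.act σ))
  rw [← BiTabloid.op_smul_mk]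
  have h := Finsupp.mapDomain_apply (M := K) (MulAction.injective (op σ)⁻¹) x.1
    (op σ • BiTabloid.mk s)
  rw [inv_smul_smul] at h
  exact h

theorem coefficient_act_of_mem_rowGroup (s : BiTableau lam) {σ : Hyperoctahedral n}
    (hσ : σ ∈ s.rowGroup) : coefficient K (s.act σ) = coefficient K s := by
  rw [coefficient, BiTabloid.mk_act_of_mem s hσ]
  rfl

/-- In the permutation module the bitabloids of `s` and `s.act c` are unrelated. The identity holds
only for the functionals restricted to the Specht module, because there every polytabloid either is
negated by the sign change or does not involve `{s}`. -/
theorem coefficient_act_signChange_left (s : BiTableau lam) (b : lam.left.cells) :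
    coefficient K (s.act (signChange (s.left b).1)) = -coefficient K s := by
  refine dualSpecht_ext K fun t => ?_
  set c := signChange (s.left b).1 with hc
  -- Writing the test polytabloid as a translate by `c` moves the action off the coefficient
  -- functional: its value becomes the coefficient of `{s}` in `e_t`.
  obtain ⟨t, rfl⟩ : ∃ t', t = BiTableau.act t' c :=
    ⟨t.act c⁻¹, by rw [← BiTableau.act_mul, inv_mul_cancel, BiTableau.act_one]⟩
  rw [← dualSpechtModule_coefficient, dualSpechtModule_apply, LinearMap.neg_apply,
    coefficient_apply, coefficient_apply]
  change polytabloid K t _ = -polytabloid K (t.act c) _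
  rcases t.exists_left_or_right (s.left b).1 with ⟨d, hd⟩ | ⟨d, hd⟩
  · have hmem : c ∈ t.colGroup := by
      rw [hc, ← hd]
      exact t.signChange_mem_colGroup d
    rw [polytabloid_act_of_mem_colGroup K t hmem, hc, sgn_signChange]
    simp
  · rw [hc, ← hd, polytabloid_act_signChange_right, polytabloid_apply_eq_zero K s t b d hd.symm,
      neg_zero]

variable {K}

theorem spechtPolytabloid_act_of_sgn (t : BiTableau lam) {σ : Hyperoctahedral n}
    (hσ : σ ∈ t.colGroup) (h : sgn σ = -1) :
    spechtPolytabloid K (t.act σ) = -spechtPolytabloid K t := by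
  apply Subtype.ext
  change polytabloid K (t.act σ) = -polytabloid K t
  rw [polytabloid_act_of_mem_colGroup K t hσ, h]
  simp

/-- The pairing of bitableaux defined by `F` is invariant under the group; every vanishing statement
below comes from choosing a `σ` that changes the sign of exactly one side. -/
theorem apply_coefficient_act
    (F : Module.Dual K (spechtSubrepresentation K lam).toSubmodule →ₗ[K]
      Module.Dual K (spechtSubrepresentation K mu).toSubmodule)
    (hF : ∀ σ v, F (dualSpechtModule K lam (op σ) v) = dualSpechtModule K mu (op σ) (F v))
    (s : BiTableau lam) (t : BiTableau mu) (σ : Hyperoctahedral n) :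
    F (coefficient K (s.act σ)) (spechtPolytabloid K (t.act σ)) =
      F (coefficient K s) (spechtPolytabloid K t) := by
  rw [← dualSpechtModule_coefficient, hF, dualSpechtModule_apply]

/-- If a homomorphism between dual Specht modules pairs the tableaux `s` and `t` nontrivially, then
no odd element lies in the row group of `s` and the column group of `t`. -/
theorem apply_coefficient_eq_zero (hK : ringChar K ≠ 2)
    (F : Module.Dual K (spechtSubrepresentation K lam).toSubmodule →ₗ[K]
      Module.Dual K (spechtSubrepresentation K mu).toSubmodule)
    (hF : ∀ σ v, F (dualSpechtModule K lam (op σ) v) = dualSpechtModule K mu (op σ) (F v))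
    (s : BiTableau lam) (t : BiTableau mu) {σ : Hyperoctahedral n} (hs : σ ∈ s.rowGroup)
    (ht : σ ∈ t.colGroup) (hσ : sgn σ = -1) :
    F (coefficient K s) (spechtPolytabloid K t) = 0 := by
  have h := apply_coefficient_act F hF s t σ
  rw [coefficient_act_of_mem_rowGroup K s hs, spechtPolytabloid_act_of_sgn t ht hσ] at h
  exact (Ring.eq_self_iff_eq_zero_of_char_ne_two hK).1 
    ((LinearMap.map_neg (F (coefficient K s)) (spechtPolytabloid K t)).symm.trans h)

/-- Each odd element fixing `{s}` and negating `e_t` is excluded, and so is a sign change negating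
the coefficient of `{s}` and fixing `e_t`. What survives is a matching of the boxes of `s` with
those of `t` to which the counting argument for dominance applies in both components. -/
theorem dominates_of_apply_ne_zero (hK : ringChar K ≠ 2)
    (F : Module.Dual K (spechtSubrepresentation K lam).toSubmodule →ₗ[K]
      Module.Dual K (spechtSubrepresentation K mu).toSubmodule)
    (hF : ∀ σ v, F (dualSpechtModule K lam (op σ) v) = dualSpechtModule K mu (op σ) (F v))
    (s : BiTableau lam) (t : BiTableau mu)
    (hst : F (coefficient K s) (spechtPolytabloid K t) ≠ 0) : mu.Dominates lam := by
  have odd : ∀ σ, σ ∈ s.rowGroup → σ ∈ t.colGroup → sgn σ ≠ -1 := fun σ h1 h2 h3 =>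
    hst (apply_coefficient_eq_zero hK F hF s t h1 h2 h3)
  have hrl : ∀ b c, (s.right b).1 ≠ (t.left c).1 := fun b c h =>
    odd _ (s.signChange_mem_rowGroup b) (h ▸ t.signChange_mem_colGroup c) (sgn_signChange _)
  -- Here the sign change is in neither of the two groups, so the exclusion of odd elements does not
  -- apply; instead it negates the coefficient functional and fixes the polytabloid.
  have hlr : ∀ b c, (s.left b).1 ≠ (t.right c).1 := fun b c h => by
    have h1 := apply_coefficient_act F hF s t (signChange (s.left b).1)
    rw [coefficient_act_signChange_left] at h1
    have h2 : spechtPolytabloid K (t.act (signChange (s.left b).1)) = spechtPolytabloid K t := by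
      rw [h]
      exact Subtype.ext (polytabloid_act_signChange_right K t c)
    rw [h2, map_neg, LinearMap.neg_apply] at h1
    exact hst ((Ring.eq_self_iff_eq_zero_of_char_ne_two hK).1 h1)
  have hleft : ∀ b, ∃ c, (t.left c).1 = (s.left b).1 := fun b =>
    (t.exists_left_or_right (s.left b).1).resolve_right fun ⟨c, hc⟩ => hlr b c hc.symm
  have hright : ∀ b, ∃ c, (t.right c).1 = (s.right b).1 := fun b =>
    (t.exists_left_or_right (s.right b).1).resolve_left fun ⟨c, hc⟩ => hrl b c hc.symm
  choose φ hφ using hleft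
  choose ψ hψ using hright
  have φinj : Function.Injective φ := fun p q h =>
    s.left_injective (by simp only [← hφ, h])
  have ψinj : Function.Injective ψ := fun p q h =>
    s.right_injective (by simp only [← hψ, h])
  have φcol : ∀ p q : lam.left.cells, p.1.1 = q.1.1 → (φ p).1.2 = (φ q).1.2 → p = q := by
    intro p q hrow hcol
    by_contra hpq
    have hab : (s.left p).1 ≠ (s.left q).1 := fun h => hpq (s.left_injective h)
    obtain ⟨ε, hε⟩ := Vertex.exists_eq_scale (hφ p).symm
    obtain ⟨ε', hε'⟩ := Vertex.exists_eq_scale (hφ q).symm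
    -- Rows of the first tableau allow no sign changes while its columns do, so the entries of `s`
    -- are interchanged exactly and those of `t` up to sign.
    refine odd (signedSwap _ _ hab) ⟨?_, ?_⟩ ⟨?_, ?_⟩ (sgn_signedSwap _ _ hab)
    · exact signedSwap_mem _ _ s.left_injective hrow (Subgroup.one_mem _) (Subgroup.one_mem _)
        (Vertex.scale_one _).symm (Vertex.scale_one _).symm hab
    · exact signedSwap_mem_of_ne _ _ hab (fun c => (s.left_ne_right p c).symm)
        fun c => (s.left_ne_right q c).symm
    · exact signedSwap_mem _ _ t.left_injective hcol (Subgroup.mem_top _) (Subgroup.mem_top _)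
        hε hε' hab
    · exact signedSwap_mem_of_ne _ _ hab (fun c => (hlr p c).symm) fun c => (hlr q c).symm
  have ψcol : ∀ p q : lam.right.cells, p.1.1 = q.1.1 → (ψ p).1.2 = (ψ q).1.2 → p = q := by
    intro p q hrow hcol
    by_contra hpq
    -- In the second component the roles are reversed: signs are free in rows but not in columns, so
    -- the transposition is built from the entries of `t`.
    have hab : (t.right (ψ p)).1 ≠ (t.right (ψ q)).1 := fun h =>
      hpq (ψinj (t.right_injective h))
    obtain ⟨ε, hε⟩ := Vertex.exists_eq_scale (hψ p)
    obtain ⟨ε', hε'⟩ := Vertex.exists_eq_scale (hψ q)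
    refine odd (signedSwap _ _ hab) ⟨?_, ?_⟩ ⟨?_, ?_⟩ (sgn_signedSwap _ _ hab)
    · exact signedSwap_mem_of_ne _ _ hab (fun c => hlr c _) fun c => hlr c _
    · exact signedSwap_mem _ _ s.right_injective hrow (Subgroup.mem_top _) (Subgroup.mem_top _)
        hε hε' hab
    · exact signedSwap_mem_of_ne _ _ hab (fun c => t.left_ne_right c _)
        fun c => t.left_ne_right c _
    · exact signedSwap_mem _ _ t.right_injective hcol (Subgroup.one_mem _) (Subgroup.one_mem _)
        (Vertex.scale_one _).symm (Vertex.scale_one _).symm hab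
  -- The two injections give inequalities in both components, and both bipartitions have the same
  -- total.
  have hcard : lam.left.card = mu.left.card := by
    have h1 : lam.left.card ≤ mu.left.card := by
      simpa using Fintype.card_le_of_injective φ φinj
    have h2 : lam.right.card ≤ mu.right.card := by
      simpa using Fintype.card_le_of_injective ψ ψinj
    have := lam.card_add_card
    have := mu.card_add_card
    omega
  exact ⟨YoungDiagram.sum_rowLen_le_of_map φ φinj φcol, fun j =>
    hcard ▸ Nat.add_le_add_left (YoungDiagram.sum_rowLen_le_of_map ψ ψinj ψcol j) _⟩

/-- There is no nonzero homomorphism from `S'(lam)` to `S'(mu)` if `lam` strictly dominates `mu`. -/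
theorem dualSpechtModule_hom_eq_zero (hK : ringChar K ≠ 2) (h : lam.Dominates mu) (hne : lam ≠ mu)
    (F : Module.Dual K (spechtSubrepresentation K lam).toSubmodule →ₗ[K]
      Module.Dual K (spechtSubrepresentation K mu).toSubmodule)
    (hF : ∀ σ v, F (dualSpechtModule K lam (op σ) v) = dualSpechtModule K mu (op σ) (F v)) :
    F = 0 := by
  refine LinearMap.ext_on_range (span_coefficient K) fun s => dualSpecht_ext K fun t => ?_
  by_contra hst
  exact hne (h.antisymm (dominates_of_apply_ne_zero hK F hF s t hst))

end SpechtHom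

/-! ### Horizontal edges of diagrams under concatenation -/

namespace BrauerDiagram

variable {V : Type*}

theorem comp_partner_inl [Finite V] {d e : BrauerDiagram V} {v w : V}
    (h : d.partner (.inl v) = .inl w) : (d.comp e).partner (.inl v) = .inl w := by
  rw [comp_partner_eq_iff]
  refine ⟨h ▸ d.partner_ne _, ?_⟩
  have := stack_up d e (.inl v)
  rwa [h] at this

theorem comp_partner_inr [Finite V] {d e : BrauerDiagram V} {v w : V}
    (h : e.partner (.inr v) = .inr w) : (d.comp e).partner (.inr v) = .inr w := by
  rw [comp_partner_eq_iff]
  refine ⟨h ▸ e.partner_ne _, ?_⟩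
  have := stack_inr d e (.inr v)
  rwa [h] at this

theorem comp_partner_inl_inr [Finite V] {d e : BrauerDiagram V} {u v w : V}
    (h : d.partner (.inl u) = .inr v) (h' : e.partner (.inl v) = .inr w) :
    (d.comp e).partner (.inl u) = .inr w := by
  rw [comp_partner_eq_iff]
  refine ⟨Sum.inr_ne_inl, ?_⟩
  have h1 := stack_up d e (.inl u)
  have h2 := stack_inr d e (.inl v)
  rw [h] at h1
  rw [h'] at h2
  exact (stack d e).trans h1 h2

theorem partner_injective (d : BrauerDiagram V) : Function.Injective d.partner :=
  Function.LeftInverse.injective d.partner_partner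

theorem partner_eq_comm (d : BrauerDiagram V) {x y : V ⊕ V} (h : d.partner x = y) :
    d.partner y = x := by
  rw [← h, d.partner_partner]

/-- Both rows have the same number of end points of horizontal edges. -/
theorem card_filter_inl_eq_inr [Fintype V] (d : BrauerDiagram V)
    [DecidablePred fun v : V => ∃ w, d.partner (.inl v) = .inl w]
    [DecidablePred fun v : V => ∃ w, d.partner (.inr v) = .inr w] :
    (Finset.univ.filter fun v : V => ∃ w, d.partner (.inl v) = .inl w).card =
      (Finset.univ.filter fun v : V => ∃ w, d.partner (.inr v) = .inr w).card := by
  -- The vertical edges match the remaining vertices of the two rows.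
  have h : (Finset.univ.filter fun v : V => ¬ ∃ w, d.partner (.inl v) = .inl w).card =
      (Finset.univ.filter fun v : V => ¬ ∃ w, d.partner (.inr v) = .inr w).card := by
    have h1 : ∀ v : V, (¬ ∃ w, d.partner (.inl v) = .inl w) →
        ∃ w, d.partner (.inl v) = .inr w := fun v hv => by
      rcases h : d.partner (.inl v) with w | w
      · exact (hv ⟨w, h⟩).elim
      · exact ⟨w, rfl⟩
    have h2 : ∀ v : V, (¬ ∃ w, d.partner (.inr v) = .inr w) →
        ∃ w, d.partner (.inr v) = .inl w := fun v hv => by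
      rcases h : d.partner (.inr v) with w | w
      · exact ⟨w, rfl⟩
      · exact (hv ⟨w, h⟩).elim
    refine Finset.card_bij (fun v hv => (h1 v (Finset.mem_filter.1 hv).2).choose) ?_ ?_ ?_
    · intro v hv
      have h := (h1 v (Finset.mem_filter.1 hv).2).choose_spec
      refine Finset.mem_filter.2 ⟨Finset.mem_univ _, ?_⟩
      rintro ⟨w, hw⟩
      exact Sum.inl_ne_inr ((d.partner_eq_comm h).symm.trans hw)
    · intro v hv w hw hvw
      have h := (h1 v (Finset.mem_filter.1 hv).2).choose_spec
      have h' := (h1 w (Finset.mem_filter.1 hw).2).choose_spec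
      exact Sum.inl_injective (d.partner_injective (h.trans ((congrArg _ hvw).trans h'.symm)))
    · intro w hw
      obtain ⟨v, hv⟩ := h2 w (Finset.mem_filter.1 hw).2
      have hv' := d.partner_eq_comm hv
      have hmem : v ∈ Finset.univ.filter fun v : V => ¬ ∃ w, d.partner (.inl v) = .inl w :=
        Finset.mem_filter.2 ⟨Finset.mem_univ _, fun ⟨u, hu⟩ =>
          Sum.inl_ne_inr (hu.symm.trans hv')⟩
      refine ⟨v, hmem, ?_⟩
      have h := (h1 v (Finset.mem_filter.1 hmem).2).choose_spec
      exact Sum.inr_injective (h.symm.trans hv')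
  have h1 := Finset.card_filter_add_card_filter_not (s := (Finset.univ : Finset V))
    fun v : V => ∃ w, d.partner (.inl v) = .inl w
  have h2 := Finset.card_filter_add_card_filter_not (s := (Finset.univ : Finset V))
    fun v : V => ∃ w, d.partner (.inr v) = .inr w
  omega

end BrauerDiagram

theorem Hyperoctahedral.extend_shift {r l : ℕ} (σ : Hyperoctahedral (r - l))
    (y : Vertex (r - l)) :
    (extend r l σ).1 (Vertex.shift r l y) = Vertex.shift r l (σ.1 y) :=
  Equiv.Perm.viaEmbedding_apply _ _ _

namespace DiagramC

variable {r : ℕ}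

theorem numArcs_le_mul_right (d e : DiagramC r) : numArcs d ≤ numArcs (d * e) := by
  refine Nat.div_le_div_right (Finset.card_le_card fun v hv => ?_)
  obtain ⟨w, hw⟩ := (Finset.mem_filter.1 hv).2
  exact Finset.mem_filter.2 ⟨Finset.mem_univ _, w, BrauerDiagram.comp_partner_inl hw⟩

/-- The horizontal edges in the bottom row of `e` survive in the product, so the count is
transferred to the bottom row, where it is the same. -/
theorem numArcs_le_mul_left (d e : DiagramC r) : numArcs e ≤ numArcs (d * e) := by
  classical
  have key : ∀ d : DiagramC r, numArcs d =
      (Finset.univ.filter fun v : Vertex r => ∃ w, d.1.partner (.inr v) = .inr w).card / 2 := by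
    intro d
    exact congrArg (· / 2) (BrauerDiagram.card_filter_inl_eq_inr d.1)
  rw [key, key]
  refine Nat.div_le_div_right (Finset.card_le_card fun v hv => ?_)
  obtain ⟨w, hw⟩ := (Finset.mem_filter.1 hv).2
  exact Finset.mem_filter.2 ⟨Finset.mem_univ _, w, BrauerDiagram.comp_partner_inr hw⟩

theorem arcs_inl_of_lt {l : ℕ} {v : Vertex r} (h : v.1.1 < l) :
    (arcs r l).1.partner (.inl v) = .inl v.neg := if_pos h

theorem arcs_inr_of_lt {l : ℕ} {v : Vertex r} (h : v.1.1 < l) :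
    (arcs r l).1.partner (.inr v) = .inr v.neg := if_pos h

theorem arcs_inl_of_le {l : ℕ} {v : Vertex r} (h : l ≤ v.1.1) :
    (arcs r l).1.partner (.inl v) = .inr v := if_neg h.not_gt

theorem arcs_inr_of_le {l : ℕ} {v : Vertex r} (h : l ≤ v.1.1) :
    (arcs r l).1.partner (.inr v) = .inl v := if_neg h.not_gt

theorem card_filter_lt {l : ℕ} (hl : l ≤ r) :
    (Finset.univ.filter fun v : Vertex r => v.1.1 < l).card = 2 * l := by
  have h : (Finset.univ.filter fun v : Vertex r => v.1.1 < l) =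
      (Finset.univ.filter fun i : Fin r => i.1 < l) ×ˢ Finset.univ := by
    ext v
    simp only [Finset.mem_filter, Finset.mem_univ, true_and, Finset.mem_product, and_true]
  rw [h, Finset.card_product, Fin.card_filter_val_lt, min_eq_right hl]
  simp [mul_comm]

theorem numArcs_arcs {l : ℕ} (hl : l ≤ r) : numArcs (arcs r l) = l := by
  classical
  rw [numArcs]
  have h : (Finset.univ.filter fun v : Vertex r =>
      ∃ w, (arcs r l).1.partner (.inl v) = .inl w) =
      Finset.univ.filter fun v : Vertex r => v.1.1 < l := by
    refine Finset.filter_congr fun v _ => ⟨?_, fun h => ⟨_, arcs_inl_of_lt h⟩⟩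
    rintro ⟨w, hw⟩
    by_contra h
    rw [arcs_inl_of_le (not_lt.1 h)] at hw
    exact Sum.inr_ne_inl hw
  have h2 := card_filter_lt hl
  rw [← h] at h2
  rw [show ∀ a, a = 2 * l → a / 2 = l by omega]
  convert h2

theorem arcs_mul_arcs (l : ℕ) : arcs r l * arcs r l = arcs r l := by
  refine Subtype.ext (BrauerDiagram.ext (funext fun x => ?_))
  change ((arcs r l).1.comp (arcs r l).1).partner x = _
  rcases x with v | v
  · rcases lt_or_ge v.1.1 l with h | h
    · rw [BrauerDiagram.comp_partner_inl (arcs_inl_of_lt h), arcs_inl_of_lt h]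
    · rw [BrauerDiagram.comp_partner_inl_inr (arcs_inl_of_le h) (arcs_inl_of_le h),
        arcs_inl_of_le h]
  · rcases lt_or_ge v.1.1 l with h | h
    · rw [BrauerDiagram.comp_partner_inr (arcs_inr_of_lt h), arcs_inr_of_lt h]
    · rw [arcs_inr_of_le h]
      exact BrauerDiagram.partner_eq_comm _
        (BrauerDiagram.comp_partner_inl_inr (arcs_inl_of_le h) (arcs_inl_of_le h))

theorem arcs_mul_ofPerm_inl_shift {l : ℕ} (σ : Hyperoctahedral (r - l))
    (y : Vertex (r - l)) :
    (arcs r l * ofPerm (Hyperoctahedral.extend r l σ)).1.partner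
      (.inl (Vertex.shift r l (σ.1 y))) = .inr (Vertex.shift r l y) := by
  refine BrauerDiagram.comp_partner_inl_inr
    (arcs_inl_of_le ((Vertex.mem_range_shift _).1 ⟨_, rfl⟩)) ?_
  rw [← Hyperoctahedral.extend_shift]
  exact congrArg Sum.inr (Equiv.symm_apply_apply _ _)

theorem arcs_mul_ofPerm_injective (l : ℕ) :
    Function.Injective fun σ : Hyperoctahedral (r - l) =>
      arcs r l * ofPerm (Hyperoctahedral.extend r l σ) := by
  intro σ τ h
  refine Subtype.ext (Equiv.ext fun y => ?_)
  have h1 := arcs_mul_ofPerm_inl_shift σ y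
  have h2 := arcs_mul_ofPerm_inl_shift τ y
  rw [show arcs r l * ofPerm (Hyperoctahedral.extend r l σ) =
    arcs r l * ofPerm (Hyperoctahedral.extend r l τ) from h, ← h2] at h1
  exact (Vertex.shift r l).injective (Sum.inl_injective (BrauerDiagram.partner_injective _ h1))

/-- Multiplication never decreases the number of horizontal edges, and multiplying by `σ⁻¹` gives
back `arcs r l`. -/
theorem numArcs_arcs_mul_ofPerm {l : ℕ} (hl : l ≤ r) (σ : Hyperoctahedral r) :
    numArcs (arcs r l * ofPerm σ) ≤ l := by
  refine (numArcs_le_mul_right _ (ofPerm σ⁻¹)).trans ?_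
  rw [mul_assoc, ofPerm_mul, mul_inv_cancel]
  exact ((congrArg numArcs (mul_one (arcs r l))).trans (numArcs_arcs hl)).le

/-- A diagram which has the same horizontal edges as `arcs r l` is obtained from `arcs r l` by a
permutation of the outer vertices. -/
theorem exists_eq_arcs_mul_ofPerm {l : ℕ} (hl : l ≤ r) (d : DiagramC r)
    (hin : ∀ v : Vertex r, v.1.1 < l → d.1.partner (.inl v) = .inl v.neg)
    (hout : ∀ v : Vertex r, v.1.1 < l → d.1.partner (.inr v) = .inr v.neg)
    (hd : numArcs d ≤ l) :
    ∃ σ : Hyperoctahedral (r - l), d = arcs r l * ofPerm (Hyperoctahedral.extend r l σ) := by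
  classical
  have hvert : ∀ v : Vertex r, l ≤ v.1.1 → ∃ w, d.1.partner (.inl v) = .inr w := by
    intro v hv
    rcases hw : d.1.partner (.inl v) with w | w
    · exfalso
      have hw' := d.1.partner_eq_comm hw
      have hwl : l ≤ w.1.1 := by
        by_contra h
        rw [hin w (not_le.1 h)] at hw'
        obtain rfl := Sum.inl_injective hw'
        exact h hv
      have hvw : v ≠ w := fun h => d.1.partner_ne (.inl v) (hw.trans (by rw [h]))
      -- A further edge `{v, w}` in the top row, besides those on the `2 * l` inner vertices, would
      -- give `2 * l + 2` end points, hence more than `l` horizontal edges.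
      have hsub : insert v (insert w (Finset.univ.filter fun v : Vertex r => v.1.1 < l)) ⊆
          Finset.univ.filter fun v : Vertex r => ∃ w, d.1.partner (.inl v) = .inl w := by
        intro x hx
        refine Finset.mem_filter.2 ⟨Finset.mem_univ _, ?_⟩
        rcases Finset.mem_insert.1 hx with rfl | hx
        · exact ⟨w, hw⟩
        rcases Finset.mem_insert.1 hx with rfl | hx
        · exact ⟨v, hw'⟩
        · exact ⟨_, hin x (Finset.mem_filter.1 hx).2⟩
      have hcard := Finset.card_le_card hsub
      rw [Finset.card_insert_of_notMem, Finset.card_insert_of_notMem, card_filter_lt hl] at hcard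
      · rw [numArcs] at hd
        have : ∀ a : ℕ, 2 * l + 1 + 1 ≤ a → ¬ a / 2 ≤ l := by omega
        refine this _ ?_ hd
        convert hcard
      · simpa using hwl
      · simpa [hvw] using hv
    · exact ⟨w, rfl⟩
  -- A vertical edge cannot end at an inner vertex of the bottom row, as these are used by the
  -- prescribed horizontal edges.
  have hshift : ∀ y : Vertex (r - l), ∃ z,
      d.1.partner (.inl (Vertex.shift r l y)) = .inr (Vertex.shift r l z) := by
    intro y
    obtain ⟨w, hw⟩ := hvert _ ((Vertex.mem_range_shift _).1 ⟨y, rfl⟩)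
    have hwl : l ≤ w.1.1 := by
      by_contra h
      have := d.1.partner_eq_comm hw
      rw [hout w (not_le.1 h)] at this
      exact Sum.inr_ne_inl this
    obtain ⟨z, rfl⟩ := (Vertex.mem_range_shift w).2 hwl
    exact ⟨z, hw⟩
  choose τ hτ using hshift
  have τinj : Function.Injective τ := fun y z h =>
    (Vertex.shift r l).injective (Sum.inl_injective (d.1.partner_injective
      ((hτ y).trans ((congrArg _ (congrArg _ h)).trans (hτ z).symm))))
  have τneg : ∀ y, τ y.neg = (τ y).neg := fun y => by
    have h := d.2 (.inl (Vertex.shift r l y))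
    rw [hτ] at h
    exact (Vertex.shift r l).injective (Sum.inr_injective ((hτ y.neg).symm.trans h))
  let ρ : Hyperoctahedral (r - l) :=
    ⟨Equiv.ofBijective τ (Finite.injective_iff_bijective.1 τinj), τneg⟩
  -- The map `τ` leads from the top row to the bottom row, whereas the diagram of `σ` joins `σ x` in
  -- the top row to `x` in the bottom row; hence the inverse.
  refine ⟨ρ⁻¹, Subtype.ext (BrauerDiagram.ext (funext fun x => ?_))⟩
  have key : ∀ y, (arcs r l * ofPerm (Hyperoctahedral.extend r l ρ⁻¹)).1.partner
      (.inl (Vertex.shift r l y)) = .inr (Vertex.shift r l (τ y)) := fun y => by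
    have h := arcs_mul_ofPerm_inl_shift ρ⁻¹ (τ y)
    rwa [show (ρ⁻¹).1 (τ y) = y from Equiv.symm_apply_apply ρ.1 y] at h
  rcases x with v | v
  · rcases lt_or_ge v.1.1 l with h | h
    · rw [hin v h]
      exact (BrauerDiagram.comp_partner_inl (arcs_inl_of_lt h)).symm
    · obtain ⟨y, rfl⟩ := (Vertex.mem_range_shift v).2 h
      rw [hτ, key]
  · rcases lt_or_ge v.1.1 l with h | h
    · rw [hout v h, ← ofPerm_mul_arcs]
      exact (BrauerDiagram.comp_partner_inr (arcs_inr_of_lt h)).symm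
    · obtain ⟨z, rfl⟩ := (Vertex.mem_range_shift v).2 h
      obtain ⟨y, rfl⟩ := (Finite.injective_iff_bijective.1 τinj).2 z
      rw [d.1.partner_eq_comm (hτ y), BrauerDiagram.partner_eq_comm _ (key y)]

/-- The product keeps the edges `{-i, i}` of the outer factors in both rows. If it has no further
horizontal edges, it is `arcs r l` times a permutation of the outer vertices. -/
theorem arcs_mul_mul_arcs {l : ℕ} (hl : l ≤ r) (d : DiagramC r) :
    l + 1 ≤ numArcs (arcs r l * d * arcs r l) ∨ ∃ σ : Hyperoctahedral (r - l),
      arcs r l * d * arcs r l = arcs r l * ofPerm (Hyperoctahedral.extend r l σ) := by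
  rcases lt_or_ge l (numArcs (arcs r l * d * arcs r l)) with h | h
  · exact .inl h
  · exact .inr (exists_eq_arcs_mul_ofPerm hl _
      (fun v hv => BrauerDiagram.comp_partner_inl
        (BrauerDiagram.comp_partner_inl (arcs_inl_of_lt hv)))
      (fun v hv => BrauerDiagram.comp_partner_inr (arcs_inr_of_lt hv)) h)

end DiagramC

/-! ### The ideals `J_l` and coordinates on the layers -/

namespace BrauerC

open MulOpposite
open scoped TensorProduct

variable {K : Type*} [Field K] {r : ℕ} {δ : K}

/-- The span of the diagrams with at least `l` horizontal edges. -/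
noncomputable def arcSpan (K : Type*) [Field K] (r : ℕ) (δ : K) (l : ℕ) :
    Submodule K (BrauerC K r δ) :=
  Submodule.span K {x | ∃ d : DiagramC r, l ≤ d.numArcs ∧ x = basis δ d}

theorem basis_induction {p : BrauerC K r δ → Prop} (basis : ∀ d, p (basis δ d)) (zero : p 0)
    (add : ∀ x y, p x → p y → p (x + y)) (smul : ∀ (a : K) x, p x → p (a • x))
    (x : BrauerC K r δ) : p x := by
  have hx : x ∈ Submodule.span K (Set.range (BrauerC.basis δ)) :=
    (BrauerC.basis δ).span_eq ▸ Submodule.mem_top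
  induction hx using Submodule.span_induction with
  | mem x hx =>
    obtain ⟨d, rfl⟩ := hx
    exact basis d
  | zero => exact zero
  | add x y _ _ hx hy => exact add x y hx hy
  | smul a x _ hx => exact smul a x hx

theorem mul_mem_arcSpan (l : ℕ) {x y : BrauerC K r δ}
    (h : x ∈ arcSpan K r δ l ∨ y ∈ arcSpan K r δ l) : x * y ∈ arcSpan K r δ l := by
  have hbasis : ∀ d e : DiagramC r, l ≤ d.numArcs ∨ l ≤ e.numArcs →
      basis δ d * basis δ e ∈ arcSpan K r δ l := fun d e h => by
    rw [basis_mul_basis]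
    refine Submodule.smul_mem _ _ (Submodule.subset_span ⟨d * e, ?_, rfl⟩)
    rcases h with h | h
    · exact h.trans (DiagramC.numArcs_le_mul_right d e)
    · exact h.trans (DiagramC.numArcs_le_mul_left d e)
  rcases h with h | h
  · induction h using Submodule.span_induction with
    | mem x hx =>
      obtain ⟨d, hd, rfl⟩ := hx
      induction y using basis_induction with
      | basis e => exact hbasis d e (.inl hd)
      | zero => rw [mul_zero]; exact Submodule.zero_mem _
      | add x y hx hy => rw [mul_add]; exact Submodule.add_mem _ hx hy
      | smul a x hx => rw [mul_smul_comm]; exact Submodule.smul_mem _ _ hx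
    | zero => rw [zero_mul]; exact Submodule.zero_mem _
    | add x z _ _ hx hz => rw [add_mul]; exact Submodule.add_mem _ hx hz
    | smul a x _ hx => rw [smul_mul_assoc]; exact Submodule.smul_mem _ _ hx
  · induction h using Submodule.span_induction with
    | mem y hy =>
      obtain ⟨e, he, rfl⟩ := hy
      induction x using basis_induction with
      | basis d => exact hbasis d e (.inr he)
      | zero => rw [zero_mul]; exact Submodule.zero_mem _
      | add x y hx hy => rw [add_mul]; exact Submodule.add_mem _ hx hy
      | smul a x hx => rw [smul_mul_assoc]; exact Submodule.smul_mem _ _ hx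
    | zero => rw [mul_zero]; exact Submodule.zero_mem _
    | add x z _ _ hx hz => rw [mul_add]; exact Submodule.add_mem _ hx hz
    | smul a x _ hx => rw [mul_smul_comm]; exact Submodule.smul_mem _ _ hx

/-- The linear span of these diagrams is already a two-sided ideal, since products do not lose
horizontal edges. -/
theorem mem_arcSpan_of_mem_J {l : ℕ} {x : BrauerC K r δ} (hx : x ∈ J K r δ l) :
    x ∈ arcSpan K r δ l := by
  let I : TwoSidedIdeal (BrauerC K r δ) := TwoSidedIdeal.mk' (arcSpan K r δ l)
    (Submodule.zero_mem _) (Submodule.add_mem _) (Submodule.neg_mem _)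
    (fun h => mul_mem_arcSpan l (.inr h)) (fun h => mul_mem_arcSpan l (.inl h))
  have hI : J K r δ l ≤ I := TwoSidedIdeal.span_le.2 fun x hx =>
    (TwoSidedIdeal.mem_mk' _ _ _ _ _ _ _).2 (Submodule.subset_span hx)
  exact (TwoSidedIdeal.mem_mk' _ _ _ _ _ _ _).1 (hI hx)

/-- This makes the coordinates at diagrams with at most `l` horizontal edges well defined on `B /
J_{l+1}`. -/
theorem coord_eq_zero_of_mem_J {l : ℕ} {x : BrauerC K r δ} (hx : x ∈ J K r δ l)
    {d : DiagramC r} (hd : d.numArcs < l) : (basis δ).coord d x = 0 := by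
  have h : arcSpan K r δ l ≤ LinearMap.ker ((basis δ).coord d) := by
    refine Submodule.span_le.2 ?_
    rintro _ ⟨e, he, rfl⟩
    rw [SetLike.mem_coe, LinearMap.mem_ker, Module.Basis.coord_apply, Module.Basis.repr_self]
    exact Finsupp.single_eq_of_ne (by rintro rfl; omega)
  exact h (mem_arcSpan_of_mem_J hx)

/-- Left multiplication by a permutation diagram permutes the basis, without creating loops. -/
theorem coord_ofPerm_mul (s : Hyperoctahedral r) (d : DiagramC r) (x : BrauerC K r δ) :
    (basis δ).coord d (basis δ (DiagramC.ofPerm s) * x) =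
      (basis δ).coord (DiagramC.ofPerm s⁻¹ * d) x := by
  classical
  induction x using basis_induction with
  | basis e =>
    rw [basis_mul_basis, DiagramC.loops_ofPerm_left, pow_zero, one_smul,
      Module.Basis.coord_apply, Module.Basis.repr_self, Module.Basis.coord_apply,
      Module.Basis.repr_self, Finsupp.single_apply, Finsupp.single_apply]
    refine if_congr ⟨?_, ?_⟩ rfl rfl
    · rintro rfl
      rw [← mul_assoc, DiagramC.ofPerm_mul, inv_mul_cancel]
      exact (one_mul e).symm
    · rintro rfl
      rw [← mul_assoc, DiagramC.ofPerm_mul, mul_inv_cancel]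
      exact one_mul d
  | zero => rw [mul_zero, map_zero, map_zero]
  | add x y hx hy => rw [mul_add, map_add, map_add, hx, hy]
  | smul a x hx => rw [mul_smul_comm, map_smul, map_smul, hx]

/-- The scalar undoes the power of `δ` coming from the closed loops in `arcs * arcs`. Its exponent
is irrelevant below; only its invertibility matters. -/
theorem exists_idem_mul_eq (hδ : δ ≠ 0) (l : ℕ) :
    ∃ a : K, idem K r δ l * (a • basis δ (DiagramC.arcs r l)) = idem K r δ l := by
  refine ⟨(δ ^ (DiagramC.arcs r l).loops (DiagramC.arcs r l))⁻¹, ?_⟩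
  rw [idem, mul_smul_comm, smul_mul_assoc, basis_mul_basis, DiagramC.arcs_mul_arcs,
    smul_comm, inv_smul_smul₀ (pow_ne_zero _ hδ)]

variable (K r δ)

/-- The map `x ↦ e_l x` from `B` to `e_l (B / J_{l+1})`. -/
noncomputable def toLayer (l : ℕ) : BrauerC K r δ →ₗ[(BrauerC K r δ)ᵐᵒᵖ] Layer K r δ l :=
  (leftMul K r δ (l + 1) (idem K r δ l)).rangeRestrict ∘ₗ (rightJ K r δ (l + 1)).mkQ

variable {K r δ}

theorem toLayer_surjective (l : ℕ) : Function.Surjective (toLayer K r δ l) :=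
  (LinearMap.surjective_rangeRestrict _).comp (Submodule.mkQ_surjective _)

theorem op_smul_toLayer (l : ℕ) (x y : BrauerC K r δ) :
    op y • toLayer K r δ l x = toLayer K r δ l (x * y) :=
  ((toLayer K r δ l).map_smul (op y) x).symm

theorem toLayer_eq_op_smul (l : ℕ) (x : BrauerC K r δ) :
    toLayer K r δ l x = op x • toLayer K r δ l 1 := by
  rw [op_smul_toLayer, one_mul]

theorem toLayer_eq_of_idem_mul_eq {l : ℕ} {x y : BrauerC K r δ}
    (h : idem K r δ l * x = idem K r δ l * y) : toLayer K r δ l x = toLayer K r δ l y :=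
  Subtype.ext (congrArg (Submodule.Quotient.mk (p := rightJ K r δ (l + 1))) h)

theorem toLayer_eq_zero {l : ℕ} {x : BrauerC K r δ}
    (h : idem K r δ l * x ∈ J K r δ (l + 1)) : toLayer K r δ l x = 0 :=
  Subtype.ext ((Submodule.Quotient.mk_eq_zero (rightJ K r δ (l + 1))).2 h)

theorem layerAct_toLayer (l : ℕ) (σ : Hyperoctahedral (r - l)) (x : BrauerC K r δ) :
    layerAct K r δ l σ (toLayer K r δ l x) =
      toLayer K r δ l (ofHyperoctahedral K r δ l σ * x) := by
  refine Subtype.ext (congrArg (Submodule.Quotient.mk (p := rightJ K r δ (l + 1))) ?_)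
  change ofHyperoctahedral K r δ l σ * (idem K r δ l * x) =
    idem K r δ l * (ofHyperoctahedral K r δ l σ * x)
  rw [← mul_assoc, ← mul_assoc, ofHyperoctahedral_mul_idem]

/-- The coefficient of `arcs r l * σ` in an element of `e_l (B / J_{l+1})`. -/
noncomputable def layerCoeff (δ : K) {l : ℕ} (hl : l ≤ r) (σ : Hyperoctahedral (r - l)) :
    Layer K r δ l →ₗ[K] K :=
  ((rightJ K r δ (l + 1)).restrictScalars K).liftQ
      ((basis δ).coord (DiagramC.arcs r l * DiagramC.ofPerm (Hyperoctahedral.extend r l σ)))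
      (fun _ hx => coord_eq_zero_of_mem_J hx
        (Nat.lt_succ_of_le (DiagramC.numArcs_arcs_mul_ofPerm hl _))) ∘ₗ
    (Submodule.Quotient.restrictScalarsEquiv K (rightJ K r δ (l + 1))).symm.toLinearMap ∘ₗ
    (layerModule K r δ l).subtype.restrictScalars K

theorem layerCoeff_toLayer {l : ℕ} (hl : l ≤ r) (σ : Hyperoctahedral (r - l))
    (x : BrauerC K r δ) :
    layerCoeff δ hl σ (toLayer K r δ l x) =
      (basis δ).coord (DiagramC.arcs r l * DiagramC.ofPerm (Hyperoctahedral.extend r l σ))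
        (idem K r δ l * x) := rfl

/-- The coefficient of `arcs * τ` in `σ e_l x` is that of `σ⁻¹ * arcs * τ` in `e_l x`, and `σ⁻¹`
commutes with `arcs`. -/
theorem layerCoeff_layerAct {l : ℕ} (hl : l ≤ r) (σ τ : Hyperoctahedral (r - l))
    (x : Layer K r δ l) :
    layerCoeff δ hl τ (layerAct K r δ l σ x) = layerCoeff δ hl (σ⁻¹ * τ) x := by
  obtain ⟨x, rfl⟩ := toLayer_surjective l x
  rw [layerAct_toLayer, layerCoeff_toLayer, layerCoeff_toLayer, ← mul_assoc,
    ← ofHyperoctahedral_mul_idem, mul_assoc, ofHyperoctahedral, coord_ofPerm_mul,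
    ← mul_assoc, ← map_inv, DiagramC.ofPerm_mul_arcs, mul_assoc, DiagramC.ofPerm_mul,
    ← (Hyperoctahedral.extend r l).map_mul]

/-- The diagrams `arcs * σ` are distinct for distinct `σ`, and `e_l` is `δ ^ (-l)` times the one for
`σ = 1`. -/
theorem layerCoeff_one {l : ℕ} (hl : l ≤ r) (σ : Hyperoctahedral (r - l)) [Decidable (σ = 1)] :
    layerCoeff δ hl σ (toLayer K r δ l 1) = if σ = 1 then (δ ^ l)⁻¹ else 0 := by
  classical
  have h : DiagramC.arcs r l = DiagramC.arcs r l *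
      DiagramC.ofPerm (Hyperoctahedral.extend r l σ) ↔ σ = 1 := by
    rw [← (DiagramC.arcs_mul_ofPerm_injective l).eq_iff, map_one,
      show DiagramC.ofPerm (1 : Hyperoctahedral r) = 1 from rfl, mul_one]
    exact eq_comm
  rw [layerCoeff_toLayer, mul_one, idem, map_smul, Module.Basis.coord_apply,
    Module.Basis.repr_self, Finsupp.single_apply]
  simp only [h]
  split_ifs <;> simp

/-! ### Induced modules and their homomorphisms -/

section ind

variable {l : ℕ} {V W : Type*} [AddCommGroup V] [Module K V] [AddCommGroup W] [Module K W]
  (ρ : Representation K (Hyperoctahedral (r - l))ᵐᵒᵖ V)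
  (ρ' : Representation K (Hyperoctahedral (r - l))ᵐᵒᵖ W)

/-- The map `v ↦ v ⊗ e_l` from `V` to `ind_l V`. -/
noncomputable def toInd (δ : K) : V →ₗ[K] ind K δ l ρ :=
  (balanced K δ l ρ).mkQ.restrictScalars K ∘ₗ TensorProduct.mk K _ _ (toLayer K r δ l 1)

theorem toInd_apply (v : V) :
    toInd ρ δ v = Submodule.Quotient.mk (toLayer K r δ l 1 ⊗ₜ[K] v) := rfl

theorem op_smul_mk_tmul (b : BrauerC K r δ) (x : Layer K r δ l) (v : V) :
    op b • (Submodule.Quotient.mk (x ⊗ₜ[K] v) : ind K δ l ρ) =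
      Submodule.Quotient.mk ((op b • x) ⊗ₜ[K] v) := rfl

theorem mk_tmul_act (x : Layer K r δ l) (v : V) (σ : Hyperoctahedral (r - l)) :
    (Submodule.Quotient.mk (x ⊗ₜ[K] ρ (op σ) v) : ind K δ l ρ) =
      Submodule.Quotient.mk (layerAct K r δ l σ x ⊗ₜ[K] v) :=
  (Submodule.Quotient.eq _).2 (Submodule.subset_span ⟨x, v, σ, rfl⟩)

/-- Since `σ` commutes with `e_l`, one has `vσ ⊗ e_l = v ⊗ σ e_l = v ⊗ e_l σ`. -/
theorem toInd_act (v : V) (σ : Hyperoctahedral (r - l)) :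
    toInd ρ δ (ρ (op σ) v) = op (ofHyperoctahedral K r δ l σ) • toInd ρ δ v := by
  rw [toInd_apply, toInd_apply, mk_tmul_act, op_smul_mk_tmul, layerAct_toLayer,
    op_smul_toLayer, mul_one, one_mul]

theorem ind_induction {p : ind K δ l ρ → Prop} (zero : p 0)
    (add : ∀ x y, p x → p y → p (x + y))
    (mk : ∀ (b : BrauerC K r δ) v, p (op b • toInd ρ δ v)) (z : ind K δ l ρ) : p z := by
  induction z using Submodule.Quotient.induction_on with | _ z
  induction z using TensorProduct.induction_on with
  | zero => exact zero
  | tmul x v =>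
    obtain ⟨b, rfl⟩ := toLayer_surjective l x
    rw [toLayer_eq_op_smul, ← op_smul_mk_tmul]
    exact mk b v
  | add x y hx hy => exact add _ _ hx hy

/-- The elements `v ⊗ e_l` generate `ind_l V`, because `e_l` generates its layer. -/
theorem ind_hom_ext {N : Type*} [AddCommGroup N] [Module (BrauerC K r δ)ᵐᵒᵖ N]
    {f g : ind K δ l ρ →ₗ[(BrauerC K r δ)ᵐᵒᵖ] N} (h : ∀ v, f (toInd ρ δ v) = g (toInd ρ δ v)) :
    f = g := by
  refine LinearMap.ext fun z => ?_
  induction z using ind_induction with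
  | zero => rw [map_zero, map_zero]
  | add x y hx hy => rw [map_add, map_add, hx, hy]
  | mk b v => rw [map_smul, map_smul, h]

theorem op_smul_toInd {b : BrauerC K r δ} (hb : idem K r δ l * b = idem K r δ l) (v : V) :
    op b • toInd ρ δ v = toInd ρ δ v := by
  rw [toInd_apply, op_smul_mk_tmul, op_smul_toLayer, one_mul,
    toLayer_eq_of_idem_mul_eq (hb.trans (mul_one _).symm)]

/-- The ideal is two-sided, so `e_l c b` lies in `J_{l+1}` for every `c` and vanishes in the layer.
-/
theorem op_smul_ind_of_mem_J {b : BrauerC K r δ} (hb : b ∈ J K r δ (l + 1))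
    (z : ind K δ l ρ) : op b • z = 0 := by
  induction z using ind_induction with
  | zero => rw [smul_zero]
  | add x y hx hy => rw [smul_add, hx, hy, add_zero]
  | mk c v =>
    rw [smul_smul, ← op_mul, toInd_apply, op_smul_mk_tmul, op_smul_toLayer, one_mul,
      toLayer_eq_zero ((J K r δ (l + 1)).mul_mem_left _ _ ((J K r δ (l + 1)).mul_mem_left _ _ hb)),
      TensorProduct.zero_tmul]
    rfl

open scoped Classical in
/-- The map from `ind_l V` to `V` that sends `x ⊗ v` to `∑ σ, c_σ v · σ`, where `c_σ` is the
coefficient of `arcs r l * σ` in `x`. -/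
noncomputable def fromInd (δ : K) (hl : l ≤ r) : ind K δ l ρ →ₗ[K] V :=
  ((balanced K δ l ρ).restrictScalars K).liftQ
      (∑ σ : Hyperoctahedral (r - l), TensorProduct.lift
        ((LinearMap.lsmul K V).compl₁₂ (layerCoeff δ hl σ) (ρ (op σ)))) (by
    set G := ∑ σ : Hyperoctahedral (r - l), TensorProduct.lift
        ((LinearMap.lsmul K V).compl₁₂ (layerCoeff δ hl σ) (ρ (op σ))) with hG
    have hGt : ∀ x v, G (x ⊗ₜ[K] v) =
        ∑ σ : Hyperoctahedral (r - l), layerCoeff δ hl σ x • ρ (op σ) v := fun x v => by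
      rw [hG, LinearMap.sum_apply]
      rfl
    have hrel : ∀ x v σ, G (x ⊗ₜ[K] ρ (op σ) v) = G (layerAct K r δ l σ x ⊗ₜ[K] v) := by
      intro x v σ
      rw [hGt, hGt]
      refine Fintype.sum_equiv (Equiv.mulLeft σ) _ _ fun τ => ?_
      change _ = layerCoeff δ hl (σ * τ) _ • ρ (op (σ * τ)) v
      rw [layerCoeff_layerAct, inv_mul_cancel_left, op_mul, map_mul]
      rfl
    -- The relations are spanned over `B`, but `G` is only `K`-linear; quantifying over `b` makes
    -- the induction pass through the action of `B`.
    suffices h : ∀ z ∈ balanced K δ l ρ, ∀ b : (BrauerC K r δ)ᵐᵒᵖ, G (b • z) = 0 from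
      fun z hz => by simpa using h z hz 1
    intro z hz
    induction hz using Submodule.span_induction with
    | mem z hz =>
      obtain ⟨x, v, σ, rfl⟩ := hz
      intro b
      rw [smul_sub, TensorProduct.smul_tmul', TensorProduct.smul_tmul', map_sub, hrel,
        LinearMap.map_smul, sub_self]
    | zero => intro b; rw [smul_zero, map_zero]
    | add x y _ _ hx hy => intro b; rw [smul_add, map_add, hx, hy, add_zero]
    | smul a x _ hx => intro b; rw [smul_smul]; exact hx _) ∘ₗ
    (Submodule.Quotient.restrictScalarsEquiv K (balanced K δ l ρ)).symm.toLinearMap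

theorem fromInd_toInd (hl : l ≤ r) (v : V) :
    fromInd ρ δ hl (toInd ρ δ v) = (δ ^ l)⁻¹ • v := by
  classical
  change (∑ σ : Hyperoctahedral (r - l), TensorProduct.lift
        ((LinearMap.lsmul K V).compl₁₂ (layerCoeff δ hl σ) (ρ (op σ))))
        (toLayer K r δ l 1 ⊗ₜ[K] v) = _
  rw [LinearMap.sum_apply]
  change ∑ σ : Hyperoctahedral (r - l), layerCoeff δ hl σ (toLayer K r δ l 1) • ρ (op σ) v = _
  rw [Finset.sum_eq_single 1]
  · rw [layerCoeff_one, if_pos rfl, op_one, map_one]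
    rfl
  · intro σ _ hσ
    rw [layerCoeff_one, if_neg hσ, zero_smul]
  · exact fun h => (h (Finset.mem_univ _)).elim

/-- The subspace `(ind_l V) e_l` consists of the elements `v ⊗ e_l`. -/
theorem op_arcs_smul_mem_range (hl : l ≤ r) (z : ind K δ l ρ) :
    op (basis δ (DiagramC.arcs r l)) • z ∈ LinearMap.range (toInd ρ δ) := by
  induction z using ind_induction with
  | zero => rw [smul_zero]; exact Submodule.zero_mem _
  | add x y hx hy => rw [smul_add]; exact Submodule.add_mem _ hx hy
  | mk b v =>
    rw [smul_smul, ← op_mul]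
    induction b using basis_induction with
    | zero => rw [zero_mul, op_zero, zero_smul]; exact Submodule.zero_mem _
    | add x y hx hy => rw [add_mul, op_add, add_smul]; exact Submodule.add_mem _ hx hy
    | smul a x hx =>
      rw [smul_mul_assoc, op_smul, smul_assoc]
      exact Submodule.smul_mem _ _ hx
    | basis d =>
      obtain ⟨a, ha⟩ : ∃ a : K, basis δ (DiagramC.arcs r l) *
          (basis δ d * basis δ (DiagramC.arcs r l)) =
          a • basis δ (DiagramC.arcs r l * d * DiagramC.arcs r l) := by
        rw [← mul_assoc, basis_mul_basis, smul_mul_assoc, basis_mul_basis, smul_smul]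
        exact ⟨_, rfl⟩
      -- Either `e_l * d * arcs` lies in `J_{l+1}` and the vector vanishes, or it equals `a • (e_l *
      -- σ)` and the vector is `a • (vσ ⊗ e_l)`.
      rcases DiagramC.arcs_mul_mul_arcs hl d with h | ⟨σ, hσ⟩
      · rw [toInd_apply, op_smul_mk_tmul, op_smul_toLayer, one_mul, toLayer_eq_zero,
          TensorProduct.zero_tmul]
        · exact Submodule.zero_mem _
        · rw [idem, smul_mul_assoc, ha, smul_smul, ← smul_one_mul]
          exact (J K r δ (l + 1)).mul_mem_left _ _ (TwoSidedIdeal.subset_span ⟨_, h, rfl⟩)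
      · have h : op (basis δ d * basis δ (DiagramC.arcs r l)) • toInd ρ δ v =
            op (a • ofHyperoctahedral K r δ l σ) • toInd ρ δ v := by
          rw [toInd_apply, op_smul_mk_tmul, op_smul_mk_tmul, op_smul_toLayer, op_smul_toLayer,
            one_mul, one_mul, toLayer_eq_of_idem_mul_eq]
          rw [idem, smul_mul_assoc, smul_mul_assoc, ha, hσ, mul_smul_comm, ofHyperoctahedral,
            basis_mul_basis, DiagramC.loops_ofPerm_right, pow_zero, one_smul]
        rw [h, op_smul, smul_assoc, ← toInd_act]
        exact Submodule.smul_mem _ _ ⟨_, rfl⟩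

/-- If every homomorphism from `V` to `W` vanishes, so does every homomorphism from `ind_l V` to
`ind_l W`. -/
theorem ind_hom_eq_zero (hδ : δ ≠ 0) (hl : l ≤ r)
    (h : ∀ F : V →ₗ[K] W, (∀ σ v, F (ρ (op σ) v) = ρ' (op σ) (F v)) → F = 0)
    (f : ind K δ l ρ →ₗ[(BrauerC K r δ)ᵐᵒᵖ] ind K δ l ρ') : f = 0 := by
  obtain ⟨a, ha⟩ := exists_idem_mul_eq (K := K) (r := r) hδ l
  -- The vector `v ⊗ e_l` is fixed by `a • arcs`, hence so is its image, which therefore has the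
  -- form `w ⊗ e_l`.
  have hf : ∀ v, ∃ w, toInd ρ' δ w = f (toInd ρ δ v) := fun v => by
    rw [← op_smul_toInd ρ ha v, map_smul, op_smul, smul_assoc]
    exact Submodule.smul_mem _ _ (op_arcs_smul_mem_range ρ' hl _)
  -- Equivariance of `fromInd` is needed only on vectors `w ⊗ e_l`, where `fromInd` is
  -- multiplication by `δ ^ (-l)`.
  have hF := h (fromInd ρ' δ hl ∘ₗ f.restrictScalars K ∘ₗ toInd ρ δ) fun σ v => by
    obtain ⟨w, hw⟩ := hf v
    change fromInd ρ' δ hl (f (toInd ρ δ (ρ (op σ) v))) =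
      ρ' (op σ) (fromInd ρ' δ hl (f (toInd ρ δ v)))
    rw [toInd_act, map_smul, ← hw, ← toInd_act, fromInd_toInd, fromInd_toInd, map_smul]
  refine ind_hom_ext ρ fun v => ?_
  obtain ⟨w, hw⟩ := hf v
  have h0 : fromInd ρ' δ hl (f (toInd ρ δ v)) = 0 := congrArg (· v) hF
  rw [← hw, fromInd_toInd, smul_eq_zero_iff_right (inv_ne_zero (pow_ne_zero l hδ))] at h0
  rw [← hw, h0, map_zero, LinearMap.zero_apply]

/-- There is no nonzero homomorphism from `ind_l V` to `ind_m W` if `m < l`. -/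
theorem ind_hom_eq_zero_of_lt (hδ : δ ≠ 0) (hl : l ≤ r) {m : ℕ} (hm : m < l)
    {U : Type*} [AddCommGroup U] [Module K U]
    (ρ'' : Representation K (Hyperoctahedral (r - m))ᵐᵒᵖ U)
    (f : ind K δ l ρ →ₗ[(BrauerC K r δ)ᵐᵒᵖ] ind K δ m ρ'') : f = 0 := by
  obtain ⟨a, ha⟩ := exists_idem_mul_eq (K := K) (r := r) hδ l
  refine ind_hom_ext ρ fun v => ?_
  -- The image of `v ⊗ e_l` is multiplied by `a • arcs r l`, which lies in `J_{m+1}` because `arcs r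
  -- l` has `l ≥ m + 1` horizontal edges.
  rw [← op_smul_toInd ρ ha v, map_smul, LinearMap.zero_apply]
  refine op_smul_ind_of_mem_J ρ'' ?_ _
  rw [← smul_one_mul]
  exact (J K r δ (m + 1)).mul_mem_left _ _ (TwoSidedIdeal.subset_span
    ⟨_, (Nat.succ_le_of_lt hm).trans (DiagramC.numArcs_arcs hl).ge, rfl⟩)

end ind

end BrauerC

/-! ### Conclusion: the two cases of the order -/

theorem mainTheorem8 {K : Type*} [Field K] [IsAlgClosed K] (hK : ringChar K ≠ 2)
    (r : ℕ) (δ : K) (hδ : δ ≠ 0) (x y : CellIndex r) (hxy : x < y)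
    (f : CellModule K δ x →ₗ[(BrauerC K r δ)ᵐᵒᵖ] CellModule K δ y) : f = 0 := by
  obtain ⟨l, hl, lam⟩ := x
  obtain ⟨m, hm, mu⟩ := y
  rcases hxy.le with h | ⟨h, hdom⟩
  · exact BrauerC.ind_hom_eq_zero_of_lt _ hδ hl h _ f
  · obtain rfl : l = m := h
    refine BrauerC.ind_hom_eq_zero _ _ hδ hl (fun F hF => ?_) f
    refine dualSpechtModule_hom_eq_zero hK hdom (fun h => hxy.ne ?_) F hF
    obtain rfl : lam = mu := h
    rfl
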